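/- Let $\mathcal X\subset\mathbb R$ be a bounded interval with $d(x,y)=|x-y|$, let $f:\mathcal X\to\mathcal X$ be measurable, and let $\mu$ be an ergodic $f$-invariant probability measure on $\mathcal X$ that is absolutely continuous with respect to Lebesgue measure, with density $\rho\ge 0$ of bounded variation on $\mathcal X$. Assume: (A1) There are $C,c>0$ such that, for all $\varphi_1:\mathcal X\to\mathbb R$ of bounded variation, all $\varphi_2\in L^1(\mu)$ and all $j\ge 0$, $$\Bigl|\int\varphi_1\cdot\varphi_2\circ f^j\,d\mu-\int\varphi_1\,d\mu\int\varphi_2\,d\mu\Bigr|\le Ce^{-cj}\,\|\varphi_1\|_{\mathrm{BV}}\,\|\varphi_2\|_{L^1(\mu)},\qquad \|\varphi\|_{\mathrm{BV}}=\mathrm{var}(\varphi)+\sup_{\mathcal X}|\varphi|.$$ (A2) For every $a>0$ and every sequence $(s_n)$ for which there is a constant $K>1$ with $K^{-1}\le s_n/n^{-a}\le K$ for all large $n$, there are $\beta_0\in(0,1)$ and $C>0$ such that, for all large $n$ and all integers $1\le j\le(\log n)^2$, $$\mu\{x\in\mathcal X: d(x,f^jx)\le s_n\}\le C s_n^{\beta_0}.$$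 Let $(r_n)_{n\ge1}$ be a sequence of real numbers. "Eventually" means for all sufficiently large $n$ (depending on $x$), and minima are over $1\le k\le n$. (a) (Almost sure upper bounds.) Suppose that one of the following holds. (i) $\rho>0$ on $\mathcal X$ and, for all large $n$, $r_n>\dfrac{c\log\log n}{n}$, where $c$ is a constant with $2c\,\inf_{\mathcal X}\rho>1$. (ii) $\rho$ is uniformly Hölder continuous on $\mathcal X$ and there are real numbers $\gamma>\gamma_0$ such that $r_n>\dfrac{(\log n)^\gamma}{2n}$ for all large $n$ and $$\sum_{k\ge1}\int_{\mathcal X}\rho(x)e^{-\epsilon k^{\gamma_0}\rho(x)}\,dx<\infty\qquad\text{for every }\epsilon>0.$$ Then for $\mu$-a.e. $x$, $\min_{k\le n}d(f^kx,x)<r_n$ eventually. (b) (Almost sure lower bound.) Suppose that $(r_n)$ is non-increasing and $\sum_{n\ge1}\int_{\mathcal X}\mu(B(x,r_n))\,d\mu(x)<\infty$, where $B(x,r)=\{y:d(x,y)\le r\}$. Then for $\mu$-a.e. $x$, $\min_{k\le n}d(f^kx,x)>r_n$ eventually. -/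

import Mathlib

open MeasureTheory Filter Topology

namespace Recurrence

/-- The norm `‖φ‖_BV = var(φ) + sup |φ|` of a real function on `X ⊆ ℝ`. It is used only for `φ` of
bounded variation on a nonempty interval, where both terms are finite. -/
noncomputable def bvNorm (X : Set ℝ) (φ : ℝ → ℝ) : ℝ :=
  (eVariationOn φ X).toReal + sSup ((fun x => |φ x|) '' X)

/-- Decay of correlations of `BV(X)` against `L¹(μ)` with rate function `Θ`. -/
def DecayOfCorrelations (X : Set ℝ) (f : ℝ → ℝ) (μ : Measure ℝ) (Θ : ℕ → ℝ) : Prop :=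
  ∀ φ₁ φ₂ : ℝ → ℝ, BoundedVariationOn φ₁ X → Integrable φ₂ μ → ∀ j : ℕ,
    |(∫ x, φ₁ x * φ₂ (f^[j] x) ∂μ) - (∫ x, φ₁ x ∂μ) * ∫ x, φ₂ x ∂μ|
      ≤ Θ j * bvNorm X φ₁ * ∫ x, |φ₂ x| ∂μ

/-- Exponential decay of correlations of `BV(X)` against `L¹(μ)`. -/
def ExpDecayOfCorrelations (X : Set ℝ) (f : ℝ → ℝ) (μ : Measure ℝ) : Prop :=
  ∃ C > (0 : ℝ), ∃ c > (0 : ℝ), DecayOfCorrelations X f μ (fun j => C * Real.exp (-c * j))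

/-- `a_n ≈ b_n`: the ratio lies in `[c⁻¹, c]` for all large `n`, for some constant `c > 1`. -/
def Comparable (a b : ℕ → ℝ) : Prop :=
  ∃ c > (1 : ℝ), ∀ᶠ n in atTop, a n / b n ∈ Set.Icc c⁻¹ c

/-- The set `E_j(r)` of points of `X` that return to within distance `r` at time `j`. -/
def closeReturnSet (X : Set ℝ) (f : ℝ → ℝ) (j : ℕ) (r : ℝ) : Set ℝ :=
  {x ∈ X | dist x (f^[j] x) ≤ r}

/-- Short-time recurrence estimate: whenever `r_n ≈ n^{-a}` with `a > 0`, there are `β ∈ (0,1)` and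
`C > 0` with `μ(E_j(r_n)) ≤ C r_n^β` for all large `n` and all `1 ≤ j ≤ (log n)²`. -/
def ShortRecurrenceBound (X : Set ℝ) (f : ℝ → ℝ) (μ : Measure ℝ) : Prop :=
  ∀ a > (0 : ℝ), ∀ r : ℕ → ℝ, Comparable r (fun n => (n : ℝ) ^ (-a)) →
    ∃ β ∈ Set.Ioo (0 : ℝ) 1, ∃ C > (0 : ℝ), ∀ᶠ n : ℕ in atTop, ∀ j : ℕ, 1 ≤ j →
      (j : ℝ) ≤ Real.log n ^ 2 → μ.real (closeReturnSet X f j (r n)) ≤ C * r n ^ β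

/-- `(X, f, μ)` is a hyperbolic recurrent system on the bounded interval `X`, where `μ` is an
ergodic `f`-invariant probability measure with density `ρ` of bounded variation on `X`.
The values of `f` and `ρ` outside `X` play no role. -/
structure HyperbolicRecurrent (X : Set ℝ) (f : ℝ → ℝ) (μ : Measure ℝ) (ρ : ℝ → ℝ) : Prop where
  ordConnected : X.OrdConnected
  isBounded : Bornology.IsBounded X
  mapsTo : Set.MapsTo f X X
  isProbabilityMeasure : IsProbabilityMeasure μ
  /-- This includes measurability of `f` and invariance of `μ`. -/
  ergodic : Ergodic f μ
  density_nonneg : ∀ x ∈ X, 0 ≤ ρ x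
  density_bv : BoundedVariationOn ρ X
  eq_withDensity : μ = (volume.restrict X).withDensity (fun x => ENNReal.ofReal (ρ x))
  expDecay : ExpDecayOfCorrelations X f μ
  shortRecurrence : ShortRecurrenceBound X f μ

/-- `min_{1 ≤ k ≤ n} d(f^k x, x)` (a minimum over a finite nonempty set as soon as `n ≥ 1`). -/
noncomputable def minReturnDist (f : ℝ → ℝ) (n : ℕ) (x : ℝ) : ℝ :=
  sInf ((fun k : ℕ => dist (f^[k] x) x) '' Set.Icc 1 n)

end Recurrence

namespace Recurrence

/-! ### Indicators of intervals as functions of bounded variation -/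

/-! Upper bounds. Cut `X` into cells of length `ε r`. A point of a cell with no return closer than
`r` has an orbit that avoids the ball of radius `(1 - ε) r` about the cell's left endpoint.
Indicators of intervals have bounded variation, so decay of correlations makes the starting cell
almost independent of the later avoidance, at the price of a gap `q ~ log n`. To bound the avoidance
probability, split time into blocks of length `p ~ (log n)²` separated by such gaps. By a Bonferroni
inequality each block contributes a factor `1 - p μ(B) ≤ exp(-p μ(B))`, with an error governed by
the measures of `B ∩ f⁻ʲ B` for `1 ≤ j ≤ p`. For an individual ball these are not controlled, but
their average over the cells is at most `2 r S` times the measure of the set of points returning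
within `2 r` at time `j`, which (A2) makes polynomially small. The result, `exists_noReturn_bound`,
is `μ(no return) ≤ ∫ exp(-(1 - ε) n μ(B(y, (1 - ε) r))) dμ(y) + C n^(-κ)`.

Along `n = ⌊θ ^ k⌋` the polynomial error and the boundary layer of `X` are summable, so
Borel–Cantelli reduces both upper bounds to summability of the integrals, and monotonicity in time
fills in the other `n`. If `ρ ≥ m > 0`, the integral is of order `k^(-t)` with `t > 1`. If `ρ` is
Hölder, `μ(B(y, R))` is replaced by a multiple of `R ρ(y)`, and the assumed series appears.

Lower bound. Decorrelating a cell from its three-cell neighbourhood gives `μ(E_k(r)) ≤ 3 ∫ μ(B(x,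
r)) dμ + C e^(-ck)` (`exists_measure_closeReturnSet_le`). Borel–Cantelli with `r = r_k` handles all
late return times. The finitely many early ones are harmless because periodic points are null and
`r_n` eventually drops below every positive number. -/

theorem eVariationOn_sub_le (u v : ℝ → ℝ) (s : Set ℝ) :
    eVariationOn (fun x => u x - v x) s ≤ eVariationOn u s + eVariationOn v s := by
  refine iSup_le fun w => ?_
  calc _ ≤ ∑ i ∈ Finset.range w.1, (edist (u (w.2.1 (i + 1))) (u (w.2.1 i)) +
          edist (v (w.2.1 (i + 1))) (v (w.2.1 i))) := by
        refine Finset.sum_le_sum fun i _ => ?_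
        simp only [edist_dist, Real.dist_eq]
        rw [← ENNReal.ofReal_add (abs_nonneg _) (abs_nonneg _)]
        refine ENNReal.ofReal_le_ofReal ?_
        rw [show ∀ a b c d : ℝ, a - b - (c - d) = (a - c) - (b - d) by intros; ring]
        exact abs_sub _ _
    _ ≤ _ := by
        rw [Finset.sum_add_distrib]
        exact add_le_add (eVariationOn.sum_le w.2.2.1 w.2.2.2)
          (eVariationOn.sum_le w.2.2.1 w.2.2.2)

theorem eVariationOn_indicator_upperSet_le {X U : Set ℝ} (hX : Bornology.IsBounded X)
    (hU : IsUpperSet U) : eVariationOn (U.indicator 1 : ℝ → ℝ) X ≤ 1 := by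
  obtain ⟨a, b, hab⟩ : ∃ a b, X ⊆ Set.Icc a b :=
    ⟨_, _, hX.subset_Icc_sInf_sSup⟩
  rcases le_or_gt a b with h | h
  · have hm : MonotoneOn (U.indicator 1 : ℝ → ℝ) (Set.Icc a b) := by
      intro x _ y _ hxy
      by_cases hx : x ∈ U
      · simp [hx, hU hxy hx]
      · simp only [hx, not_false_eq_true, Set.indicator_of_notMem]
        exact Set.indicator_nonneg (fun _ _ => zero_le_one) _
    calc _ ≤ eVariationOn (U.indicator 1 : ℝ → ℝ) (Set.Icc a b ∩ Set.Icc a b) :=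
          eVariationOn.mono _ (by simpa using hab)
      _ ≤ ENNReal.ofReal (U.indicator 1 b - U.indicator 1 a : ℝ) :=
          (hm.eVariationOn_eq ⟨le_rfl, h⟩ ⟨h, le_rfl⟩).le
      _ ≤ ENNReal.ofReal 1 := by
          refine ENNReal.ofReal_le_ofReal ?_
          have h1 : (U.indicator 1 b : ℝ) ≤ 1 := Set.indicator_le_self' (by simp) b
          have h2 : (0 : ℝ) ≤ U.indicator 1 a := Set.indicator_nonneg (fun _ _ => zero_le_one) _
          linarith
      _ = 1 := by simp
  · have : X = ∅ := by simpa [Set.Icc_eq_empty h.not_ge] using hab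
    subst this
    simp [eVariationOn.subsingleton]

/-- An order-connected set is its upward closure minus the points lying strictly above it. Both are
upper sets, whose indicators are monotone with total rise at most 1. -/
theorem eVariationOn_indicator_le {X I : Set ℝ} (hX : Bornology.IsBounded X)
    (hI : I.OrdConnected) : eVariationOn (I.indicator 1 : ℝ → ℝ) X ≤ 2 := by
  have hU : IsUpperSet {x | ∃ i ∈ I, i ≤ x} := by
    rintro x y hxy ⟨i, hi, hix⟩
    exact ⟨i, hi, hix.trans hxy⟩
  have hV : IsUpperSet {x | (∃ i ∈ I, i ≤ x) ∧ x ∉ I} := by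
    rintro x y hxy ⟨⟨i, hi, hix⟩, hx⟩
    exact ⟨⟨i, hi, hix.trans hxy⟩, fun hy => hx (hI.out hi hy ⟨hix, hxy⟩)⟩
  have he : (I.indicator 1 : ℝ → ℝ) = fun x => {x | ∃ i ∈ I, i ≤ x}.indicator 1 x -
      {x | (∃ i ∈ I, i ≤ x) ∧ x ∉ I}.indicator 1 x := by
    ext x
    by_cases hx : x ∈ I
    · have : ∃ i ∈ I, i ≤ x := ⟨x, hx, le_rfl⟩
      simp [hx, this]
    · by_cases hi : ∃ i ∈ I, i ≤ x <;> simp [hx, hi]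
  rw [he]
  refine (eVariationOn_sub_le _ _ _).trans ?_
  calc _ ≤ (1 : ENNReal) + 1 := add_le_add (eVariationOn_indicator_upperSet_le hX hU)
        (eVariationOn_indicator_upperSet_le hX hV)
    _ = 2 := one_add_one_eq_two

theorem bvNorm_indicator_le {X I : Set ℝ} (hX : Bornology.IsBounded X)
    (hI : I.OrdConnected) : bvNorm X (I.indicator 1) ≤ 3 := by
  have h1 : (eVariationOn (I.indicator 1 : ℝ → ℝ) X).toReal ≤ 2 := by
    simpa using ENNReal.toReal_mono (by simp) (eVariationOn_indicator_le hX hI)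
  have h2 : sSup ((fun x => |(I.indicator 1 : ℝ → ℝ) x|) '' X) ≤ 1 := by
    refine Real.sSup_le ?_ zero_le_one
    rintro _ ⟨x, _, rfl⟩
    by_cases hx : x ∈ I <;> simp [hx]
  unfold bvNorm
  linarith

/-! ### Consequences of the structural assumptions -/

namespace HyperbolicRecurrent

variable {X : Set ℝ} {f : ℝ → ℝ} {μ : Measure ℝ} {ρ : ℝ → ℝ}

theorem measurePreserving (h : HyperbolicRecurrent X f μ ρ) : MeasurePreserving f μ μ :=
  h.ergodic.toMeasurePreserving

/-- Decay of correlations for indicators: intervals against arbitrary measurable sets. -/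
theorem exists_decay (h : HyperbolicRecurrent X f μ ρ) :
    ∃ C > (0 : ℝ), ∃ c > (0 : ℝ), ∀ I F : Set ℝ, I.OrdConnected → MeasurableSet F → ∀ j : ℕ,
      |μ.real (I ∩ f^[j] ⁻¹' F) - μ.real I * μ.real F| ≤ C * Real.exp (-c * j) * μ.real F := by
  have := h.isProbabilityMeasure
  obtain ⟨C, hC, c, hc, H⟩ := h.expDecay
  -- The factor 3 is the bound on the BV norm of an interval's indicator: variation 2 plus supremum
  -- 1.
  refine ⟨C * 3, by positivity, c, hc, fun I F hI hF j => ?_⟩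
  have hj : Measurable f^[j] := h.measurePreserving.measurable.iterate j
  have hbv : BoundedVariationOn (I.indicator 1 : ℝ → ℝ) X :=
    ((eVariationOn_indicator_le h.isBounded hI).trans_lt (by simp)).ne
  have key := H (I.indicator 1) (F.indicator 1) hbv
    ((integrable_const (1 : ℝ)).indicator hF) j
  have e1 : ∫ x, (I.indicator 1 x * F.indicator 1 (f^[j] x) : ℝ) ∂μ
      = μ.real (I ∩ f^[j] ⁻¹' F) := by
    rw [← integral_indicator_one (hI.measurableSet.inter (hj hF))]
    congr 1; ext x
    by_cases h1 : x ∈ I <;> by_cases h2 : f^[j] x ∈ F <;> simp [h1, h2]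
  have e2 : ∫ x, |(F.indicator 1 x : ℝ)| ∂μ = μ.real F := by
    rw [← integral_indicator_one hF]
    congr 1; ext x
    by_cases h2 : x ∈ F <;> simp [h2]
  rw [e1, e2, integral_indicator_one hF, integral_indicator_one hI.measurableSet] at key
  refine key.trans ?_
  have hb := bvNorm_indicator_le h.isBounded hI
  have hF0 : 0 ≤ μ.real F := measureReal_nonneg
  calc _ ≤ C * Real.exp (-c * j) * 3 * μ.real F := by gcongr
    _ = _ := by ring

theorem measure_compl_eq_zero (h : HyperbolicRecurrent X f μ ρ) : μ Xᶜ = 0 := by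
  rw [h.eq_withDensity]
  refine withDensity_absolutelyContinuous _ _ ?_
  rw [Measure.restrict_apply h.ordConnected.measurableSet.compl]
  simp

theorem ae_mem (h : HyperbolicRecurrent X f μ ρ) : ∀ᵐ x ∂μ, x ∈ X :=
  h.measure_compl_eq_zero

theorem nonempty (h : HyperbolicRecurrent X f μ ρ) : X.Nonempty := by
  have := h.isProbabilityMeasure
  exact h.ae_mem.exists

theorem exists_density_le (h : HyperbolicRecurrent X f μ ρ) :
    ∃ S > (0 : ℝ), ∀ x ∈ X, ρ x ≤ S := by
  obtain ⟨x₀, hx₀⟩ := h.nonempty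
  refine ⟨|ρ x₀| + (eVariationOn ρ X).toReal + 1, by positivity, fun x hx => ?_⟩
  have := h.density_bv.sub_le hx hx₀
  have := le_abs_self (ρ x₀)
  linarith

/-- The measure is dominated by a multiple of Lebesgue measure on intervals. -/
theorem exists_measureReal_Icc_le (h : HyperbolicRecurrent X f μ ρ) :
    ∃ S > (0 : ℝ), ∀ a b : ℝ, a ≤ b → μ.real (Set.Icc a b) ≤ S * (b - a) := by
  obtain ⟨S, hS, hρ⟩ := h.exists_density_le
  refine ⟨S, hS, fun a b hab => ?_⟩
  have : μ (Set.Icc a b) ≤ ENNReal.ofReal (S * (b - a)) := by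
    rw [h.eq_withDensity, withDensity_apply _ measurableSet_Icc,
      Measure.restrict_restrict measurableSet_Icc]
    calc _ ≤ ∫⁻ _ in Set.Icc a b ∩ X, ENNReal.ofReal S := by
          refine setLIntegral_mono' (measurableSet_Icc.inter h.ordConnected.measurableSet)
            fun x hx => ENNReal.ofReal_le_ofReal (hρ x hx.2)
      _ ≤ ∫⁻ _ in Set.Icc a b, ENNReal.ofReal S := lintegral_mono_set Set.inter_subset_left
      _ = _ := by
          rw [setLIntegral_const, Real.volume_Icc, ENNReal.ofReal_mul hS.le]
  exact ENNReal.toReal_le_of_le_ofReal (mul_nonneg hS.le (by linarith)) this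

/-- A lower bound for the measure of an interval on which the density is bounded below. -/
theorem le_measureReal_closedBall (h : HyperbolicRecurrent X f μ ρ) {y r m : ℝ} (hr : 0 ≤ r)
    (hm : ∀ x ∈ Metric.closedBall y r, x ∈ X ∧ m ≤ ρ x) :
    2 * r * m ≤ μ.real (Metric.closedBall y r) := by
  have := h.isProbabilityMeasure
  have hsub : Metric.closedBall y r ∩ X = Metric.closedBall y r :=
    Set.inter_eq_left.2 fun x hx => (hm x hx).1
  have : ENNReal.ofReal m * ENNReal.ofReal (2 * r) ≤ μ (Metric.closedBall y r) := by
    rw [h.eq_withDensity, withDensity_apply _ Metric.isClosed_closedBall.measurableSet,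
      Measure.restrict_restrict Metric.isClosed_closedBall.measurableSet, hsub,
      ← Real.volume_closedBall, ← setLIntegral_const]
    exact setLIntegral_mono' Metric.isClosed_closedBall.measurableSet
      fun x hx => ENNReal.ofReal_le_ofReal (hm x hx).2
  rcases le_or_gt m 0 with h0 | h0
  · exact (mul_nonpos_of_nonneg_of_nonpos (by linarith) h0).trans measureReal_nonneg
  · rw [← ENNReal.ofReal_mul h0.le] at this
    have := ENNReal.toReal_mono (by finiteness) this
    rw [ENNReal.toReal_ofReal (by positivity)] at this
    rw [mul_comm]
    exact this

end HyperbolicRecurrent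

/-! ### Partition of the line into cells -/

/-- The half-open interval `[iδ, (i+1)δ)`. -/
def cell (δ : ℝ) (i : ℤ) : Set ℝ := {x | ⌊x / δ⌋ = i}

theorem ordConnected_cell {δ : ℝ} (hδ : 0 < δ) (i : ℤ) : (cell δ i).OrdConnected :=
  (Set.ordConnected_singleton (a := i)).preimage_mono
    (Int.floor_mono.comp fun _ _ h => div_le_div_of_nonneg_right h hδ.le)

theorem measurableSet_cell {δ : ℝ} (hδ : 0 < δ) (i : ℤ) : MeasurableSet (cell δ i) :=
  (ordConnected_cell hδ i).measurableSet

theorem pairwiseDisjoint_cell (δ : ℝ) (s : Set ℤ) : s.PairwiseDisjoint (cell δ) := by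
  intro i _ j _ hij
  refine Set.disjoint_left.2 fun x (hi : _ = i) (hj : _ = j) => hij (hi ▸ hj)

theorem mem_cell_iff {δ : ℝ} (hδ : 0 < δ) {i : ℤ} {x : ℝ} :
    x ∈ cell δ i ↔ i * δ ≤ x ∧ x < (i + 1) * δ := by
  rw [cell, Set.mem_ofPred_eq, Int.floor_eq_iff, le_div_iff₀ hδ, div_lt_iff₀ hδ]

theorem abs_sub_lt_of_mem_cell {δ : ℝ} (hδ : 0 < δ) {i : ℤ} {x : ℝ} (hx : x ∈ cell δ i) :
    |x - i * δ| < δ := by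
  obtain ⟨h1, h2⟩ := (mem_cell_iff hδ).1 hx
  rw [abs_of_nonneg (by linarith)]
  linarith

/-- A bounded set is covered by finitely many cells. -/
theorem exists_finset_cells {X : Set ℝ} (hX : Bornology.IsBounded X) :
    ∃ Λ > (0 : ℝ), ∀ δ > (0 : ℝ), ∃ s : Finset ℤ, (s.card : ℝ) ≤ Λ / δ + 2 ∧
      X ⊆ ⋃ i ∈ s, cell δ i := by
  obtain ⟨R, hR, hsub⟩ := hX.subset_closedBall_lt 0 0
  refine ⟨2 * R, by positivity, fun δ hδ => ⟨Finset.Icc ⌊-R / δ⌋ ⌊R / δ⌋, ?_, ?_⟩⟩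
  · have hle : ⌊-R / δ⌋ ≤ ⌊R / δ⌋ :=
      Int.floor_mono (div_le_div_of_nonneg_right (by linarith) hδ.le)
    rw [Int.card_Icc]
    have : (((⌊R / δ⌋ + 1 - ⌊-R / δ⌋).toNat : ℤ) : ℝ) = ⌊R / δ⌋ + 1 - ⌊-R / δ⌋ := by
      rw [Int.toNat_of_nonneg (by linarith)]; push_cast; ring
    rw [← Int.cast_natCast, this]
    have h1 := Int.floor_le (R / δ)
    have h2 := Int.lt_floor_add_one (-R / δ)
    have h3 : 2 * R / δ = R / δ - -R / δ := by ring
    linarith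
  · intro x hx
    have hx' := hsub hx
    rw [Metric.mem_closedBall, Real.dist_eq, sub_zero, abs_le] at hx'
    simp only [Set.mem_iUnion]
    refine ⟨⌊x / δ⌋, ?_, rfl⟩
    rw [Finset.mem_Icc]
    exact ⟨Int.floor_mono (div_le_div_of_nonneg_right hx'.1 hδ.le),
      Int.floor_mono (div_le_div_of_nonneg_right hx'.2 hδ.le)⟩

/-! ### Probability of avoiding a set for a long time -/

/-- Points whose orbit avoids `B` at all times `0 ≤ j < n`. -/
def avoidSet (f : ℝ → ℝ) (B : Set ℝ) (n : ℕ) : Set ℝ := {x | ∀ j < n, f^[j] x ∉ B}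

section

variable {f : ℝ → ℝ} {μ : Measure ℝ} {B : Set ℝ}

theorem measurableSet_avoidSet (hf : Measurable f) (hB : MeasurableSet B) (n : ℕ) :
    MeasurableSet (avoidSet f B n) := by
  have : avoidSet f B n = ⋂ j ∈ Finset.range n, (f^[j] ⁻¹' B)ᶜ := by
    ext x; simp [avoidSet]
  rw [this]
  exact Finset.measurableSet_biInter _ fun j _ => (hf.iterate j hB).compl

theorem avoidSet_succ (f : ℝ → ℝ) (B : Set ℝ) (p : ℕ) :
    avoidSet f B (p + 1) = avoidSet f B p \ f^[p] ⁻¹' B := by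
  ext x
  simp only [avoidSet, Set.mem_ofPred_eq, Set.mem_sdiff, Set.mem_preimage]
  refine ⟨fun h => ⟨fun j hj => h j (by omega), h p (by omega)⟩, fun h j hj => ?_⟩
  rcases Nat.lt_succ_iff_lt_or_eq.1 hj with h' | rfl
  · exact h.1 j h'
  · exact h.2

theorem avoidSet_add_subset (f : ℝ → ℝ) (B : Set ℝ) {p l n : ℕ} (hp : p ≤ l + n) :
    avoidSet f B (l + n) ⊆ avoidSet f B p ∩ f^[l] ⁻¹' avoidSet f B n := by
  intro x hx
  refine ⟨fun j hj => hx j (by omega), fun j hj => ?_⟩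
  rw [← Function.iterate_add_apply]
  exact hx _ (by omega)

/-- The sum of the measures of the short self-returns of `B`. -/
noncomputable def returnSum (f : ℝ → ℝ) (μ : Measure ℝ) (B : Set ℝ) (P : ℕ) : ℝ :=
  ∑ j ∈ Finset.Icc 1 P, μ.real (B ∩ f^[j] ⁻¹' B)

theorem returnSum_nonneg (P : ℕ) : 0 ≤ returnSum f μ B P :=
  Finset.sum_nonneg fun _ _ => measureReal_nonneg

/-- By invariance, visits at times `j` and `p` together have the probability of a self-return of `B`
after `p - j` steps. The sum therefore bounds the chance that a visit at time `p` is not the first.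
-/
theorem sum_measureReal_inter_le (hf : MeasurePreserving f μ μ) (hB : MeasurableSet B)
    {p P : ℕ} (hp : p ≤ P) :
    ∑ j ∈ Finset.range p, μ.real (f^[j] ⁻¹' B ∩ f^[p] ⁻¹' B) ≤ returnSum f μ B P := by
  have hm : ∀ j, MeasurableSet (f^[j] ⁻¹' B) := fun j => hf.measurable.iterate j hB
  have h1 : ∑ j ∈ Finset.range p, μ.real (f^[j] ⁻¹' B ∩ f^[p] ⁻¹' B)
      = ∑ j ∈ Finset.range p, μ.real (B ∩ f^[p - j] ⁻¹' B) := by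
    refine Finset.sum_congr rfl fun j hj => ?_
    have hj := Finset.mem_range.1 hj
    have : f^[j] ⁻¹' B ∩ f^[p] ⁻¹' B = f^[j] ⁻¹' (B ∩ f^[p - j] ⁻¹' B) := by
      rw [Set.preimage_inter, ← Set.preimage_comp, ← Function.iterate_add,
        Nat.sub_add_cancel hj.le]
    rw [this, (hf.iterate j).measureReal_preimage (hB.inter (hm _)).nullMeasurableSet]
  rw [h1, ← Finset.sum_range_reflect, returnSum]
  have h2 : ∑ j ∈ Finset.range p, μ.real (B ∩ f^[p - (p - 1 - j)] ⁻¹' B)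
      = ∑ j ∈ Finset.range p, μ.real (B ∩ f^[j + 1] ⁻¹' B) := by
    refine Finset.sum_congr rfl fun j hj => ?_
    have hj := Finset.mem_range.1 hj
    rw [show p - (p - 1 - j) = j + 1 by omega]
  rw [h2]
  have h3 : ∑ j ∈ Finset.range p, μ.real (B ∩ f^[j + 1] ⁻¹' B)
      = ∑ j ∈ Finset.Ico 1 (p + 1), μ.real (B ∩ f^[j] ⁻¹' B) := by
    rw [Finset.sum_Ico_eq_sum_range]
    simp [add_comm]
  rw [h3]
  refine Finset.sum_le_sum_of_subset_of_nonneg ?_ fun _ _ _ => measureReal_nonneg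
  intro j hj
  simp only [Finset.mem_Ico, Finset.mem_Icc] at hj ⊢
  omega

variable [IsProbabilityMeasure μ]

/-- A Bonferroni inequality, by induction on `p`: time `p` removes from the avoiding set all of `f⁻ᵖ
B ∩ F` except the points that visited `B` earlier, and these cost at most one `returnSum`. The
constraint `F` is dropped in that error. -/
theorem measureReal_avoidSet_inter_le (hf : MeasurePreserving f μ μ) (hB : MeasurableSet B)
    (F : Set ℝ) {p P : ℕ} (hp : p ≤ P) :
    μ.real (avoidSet f B p ∩ F) ≤ μ.real F -
      ∑ j ∈ Finset.range p, μ.real (f^[j] ⁻¹' B ∩ F) + p * returnSum f μ B P := by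
  have hm : ∀ j, MeasurableSet (f^[j] ⁻¹' B) := fun j => hf.measurable.iterate j hB
  induction p with
  | zero => simpa using measureReal_mono Set.inter_subset_right
  | succ p ih =>
    have ih := ih (by omega)
    have hG := measurableSet_avoidSet hf.measurable hB p
    have h1 : μ.real (avoidSet f B p ∩ F) = μ.real (avoidSet f B p ∩ F ∩ f^[p] ⁻¹' B) +
        μ.real (avoidSet f B (p + 1) ∩ F) := by
      rw [avoidSet_succ, ← measureReal_inter_add_sdiff (s := avoidSet f B p ∩ F) (hm p)]
      congr 2
      ext x; simp only [Set.mem_sdiff, Set.mem_inter_iff]; tauto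
    have h2 : μ.real (f^[p] ⁻¹' B ∩ F) ≤ μ.real (avoidSet f B p ∩ F ∩ f^[p] ⁻¹' B) +
        returnSum f μ B P := by
      refine le_trans ?_ (add_le_add le_rfl (sum_measureReal_inter_le hf hB (by omega : p ≤ P)))
      calc _ ≤ μ.real ((avoidSet f B p ∩ F ∩ f^[p] ⁻¹' B) ∪
            ⋃ j ∈ Finset.range p, f^[j] ⁻¹' B ∩ f^[p] ⁻¹' B) := by
            refine measureReal_mono ?_
            rintro x ⟨hx, hxF⟩
            by_cases hxG : x ∈ avoidSet f B p
            · exact Or.inl ⟨⟨hxG, hxF⟩, hx⟩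
            · right
              simp only [avoidSet, Set.mem_ofPred_eq, not_forall, not_not] at hxG
              obtain ⟨j, hj, hjB⟩ := hxG
              simp only [Set.mem_iUnion]
              exact ⟨j, Finset.mem_range.2 hj, hjB, hx⟩
        _ ≤ _ := (measureReal_union_le _ _).trans
              (add_le_add le_rfl (measureReal_biUnion_finset_le _ _))
    rw [Finset.sum_range_succ]
    push_cast
    linarith

/-- One step of the blocking argument. -/
theorem measureReal_avoidSet_block_le (hf : MeasurePreserving f μ μ) (hB : MeasurableSet B)
    {D : ℝ} (hD : 0 ≤ D) {q : ℕ} (hmix : ∀ F, MeasurableSet F → ∀ j ≥ q,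
      (μ.real B - D) * μ.real F ≤ μ.real (B ∩ f^[j] ⁻¹' F)) (p n : ℕ) :
    μ.real (avoidSet f B (p + q + n)) ≤ Real.exp (-(p * μ.real B)) * μ.real (avoidSet f B n) +
      p * (D + returnSum f μ B p) := by
  set H := avoidSet f B n
  have hH : MeasurableSet H := measurableSet_avoidSet hf.measurable hB n
  have hm : ∀ j, MeasurableSet (f^[j] ⁻¹' H) := fun j => hf.measurable.iterate j hH
  -- The orbit is left unconstrained during the gap of length `q`.
  have h1 : μ.real (avoidSet f B (p + q + n)) ≤ μ.real (avoidSet f B p ∩ f^[p + q] ⁻¹' H) :=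
    measureReal_mono (avoidSet_add_subset f B (by omega))
  have h2 := measureReal_avoidSet_inter_le hf hB (f^[p + q] ⁻¹' H) (le_refl p)
  rw [(hf.iterate (p + q)).measureReal_preimage hH.nullMeasurableSet] at h2
  -- A visit at time `j < p` precedes the constraint `H`, which starts at time `p + q`, by more than
  -- `q` steps, so mixing applies to each term.
  have h3 : (p : ℝ) * ((μ.real B - D) * μ.real H) ≤
      ∑ j ∈ Finset.range p, μ.real (f^[j] ⁻¹' B ∩ f^[p + q] ⁻¹' H) := by
    calc (p : ℝ) * ((μ.real B - D) * μ.real H)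
        = ∑ j ∈ Finset.range p, (μ.real B - D) * μ.real H := by simp
      _ ≤ _ := by
        refine Finset.sum_le_sum fun j hj => ?_
        have hj := Finset.mem_range.1 hj
        have : f^[j] ⁻¹' B ∩ f^[p + q] ⁻¹' H = f^[j] ⁻¹' (B ∩ f^[p + q - j] ⁻¹' H) := by
          rw [Set.preimage_inter, ← Set.preimage_comp, ← Function.iterate_add,
            Nat.sub_add_cancel (by omega)]
        rw [this, (hf.iterate j).measureReal_preimage (hB.inter (hm _)).nullMeasurableSet]
        exact hmix H hH _ (by omega)
  have h4 : 1 - p * μ.real B ≤ Real.exp (-(p * μ.real B)) := Real.one_sub_le_exp_neg _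
  have hH0 : 0 ≤ μ.real H := measureReal_nonneg
  have hH1 : μ.real H ≤ 1 := measureReal_le_one
  have h5 : (1 - p * μ.real B) * μ.real H ≤ Real.exp (-(p * μ.real B)) * μ.real H :=
    mul_le_mul_of_nonneg_right h4 hH0
  have h6 : p * D * μ.real H ≤ p * D := mul_le_of_le_one_right (by positivity) hH1
  nlinarith

/-- Iterating the block estimate multiplies the exponential factors. As each is at most 1, the
errors merely add up. -/
theorem measureReal_avoidSet_le (hf : MeasurePreserving f μ μ) (hB : MeasurableSet B)
    {D : ℝ} (hD : 0 ≤ D) {q : ℕ} (hmix : ∀ F, MeasurableSet F → ∀ j ≥ q,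
      (μ.real B - D) * μ.real F ≤ μ.real (B ∩ f^[j] ⁻¹' F)) (p M : ℕ) :
    μ.real (avoidSet f B (M * (p + q))) ≤ Real.exp (-(M * p * μ.real B)) +
      M * p * (D + returnSum f μ B p) := by
  have hR : 0 ≤ returnSum f μ B p := returnSum_nonneg p
  induction M with
  | zero => simp
  | succ M ih =>
    have h1 := measureReal_avoidSet_block_le hf hB hD hmix p (M * (p + q))
    rw [show (M + 1) * (p + q) = p + q + M * (p + q) by ring]
    refine h1.trans ?_
    have h2 : Real.exp (-(p * μ.real B)) ≤ 1 := by
      rw [Real.exp_le_one_iff]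
      have : 0 ≤ μ.real B := measureReal_nonneg
      have : 0 ≤ p * μ.real B := by positivity
      linarith
    have h3 : Real.exp (-((M + 1 : ℕ) * p * μ.real B)) =
        Real.exp (-(p * μ.real B)) * Real.exp (-(M * p * μ.real B)) := by
      rw [← Real.exp_add]; congr 1; push_cast; ring
    have h4 := mul_le_mul_of_nonneg_left ih (Real.exp_pos (-(p * μ.real B))).le
    have h5 : Real.exp (-(p * μ.real B)) * (M * p * (D + returnSum f μ B p)) ≤
        M * p * (D + returnSum f μ B p) := mul_le_of_le_one_left (by positivity) h2
    rw [h3]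
    push_cast
    linarith

end

/-! ### Probability of not returning close to the starting point -/

/-- Points that do not return to within distance less than `r` at any time `1 ≤ j ≤ n`. -/
def noReturnSet (f : ℝ → ℝ) (n : ℕ) (r : ℝ) : Set ℝ :=
  {x | ∀ j ∈ Set.Icc 1 n, r ≤ dist (f^[j] x) x}

theorem measurableSet_closeReturnSet {X : Set ℝ} {f : ℝ → ℝ} (hX : MeasurableSet X)
    (hf : Measurable f) (j : ℕ) (r : ℝ) : MeasurableSet (closeReturnSet X f j r) :=
  hX.inter (measurableSet_le (measurable_id.dist (hf.iterate j)) measurable_const)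

theorem sum_measureReal_cell_le {μ : Measure ℝ} [IsProbabilityMeasure μ] {δ : ℝ} (hδ : 0 < δ)
    (s : Finset ℤ) {A : Set ℝ} (hA : ∀ i ∈ s, cell δ i ⊆ A) :
    ∑ i ∈ s, μ.real (cell δ i) ≤ μ.real A := by
  rw [← measureReal_biUnion_finset (pairwiseDisjoint_cell δ _) fun i _ => measurableSet_cell hδ i]
  exact measureReal_mono (Set.iUnion₂_subset hA)

namespace HyperbolicRecurrent

variable {X : Set ℝ} {f : ℝ → ℝ} {μ : Measure ℝ} {ρ : ℝ → ℝ}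

/-- The self-returns of balls, averaged over their centers. -/
theorem sum_cell_mul_measureReal_le (h : HyperbolicRecurrent X f μ ρ) {S : ℝ}
    (hS : ∀ a b : ℝ, a ≤ b → μ.real (Set.Icc a b) ≤ S * (b - a)) {ε r : ℝ} (hε : 0 < ε)
    (hr : 0 < r) (s : Finset ℤ) (j : ℕ) :
    ∑ i ∈ s, μ.real (cell (ε * r) i) *
        μ.real (Metric.closedBall (i * (ε * r)) ((1 - ε) * r) ∩
          f^[j] ⁻¹' Metric.closedBall (i * (ε * r)) ((1 - ε) * r)) ≤
      2 * r * S * μ.real (closeReturnSet X f j (2 * r)) := by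
  have := h.isProbabilityMeasure
  have hδ : 0 < ε * r := mul_pos hε hr
  set B : ℤ → Set ℝ := fun i => Metric.closedBall (i * (ε * r)) ((1 - ε) * r) with hBdef
  have hB : ∀ i, MeasurableSet (B i ∩ f^[j] ⁻¹' B i) := fun i =>
    Metric.isClosed_closedBall.measurableSet.inter
      (h.measurePreserving.measurable.iterate j Metric.isClosed_closedBall.measurableSet)
  have hE := measurableSet_closeReturnSet h.ordConnected.measurableSet
    h.measurePreserving.measurable j (2 * r)
  have e1 : ∑ i ∈ s, μ.real (cell (ε * r) i) * μ.real (B i ∩ f^[j] ⁻¹' B i) =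
      ∫ x, ∑ i ∈ s, μ.real (cell (ε * r) i) * (B i ∩ f^[j] ⁻¹' B i).indicator 1 x ∂μ := by
    rw [integral_finsetSum]
    · refine Finset.sum_congr rfl fun i _ => ?_
      rw [integral_const_mul, integral_indicator_one (hB i)]
    · exact fun i _ => ((integrable_const (1 : ℝ)).indicator (hB i)).const_mul _
  have e2 : 2 * r * S * μ.real (closeReturnSet X f j (2 * r)) =
      ∫ x, 2 * r * S * (closeReturnSet X f j (2 * r)).indicator 1 x ∂μ := by
    rw [integral_const_mul, integral_indicator_one hE]
  rw [e1, e2]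
  refine integral_mono_ae
    (integrable_finsetSum _ fun i _ => ((integrable_const (1 : ℝ)).indicator (hB i)).const_mul _)
    (((integrable_const (1 : ℝ)).indicator hE).const_mul _) ?_
  filter_upwards [h.ae_mem] with x hx
  have hS0 : 0 ≤ S := by
    have := (measureReal_nonneg (μ := μ) (s := Set.Icc 0 1)).trans (hS 0 1 zero_le_one)
    linarith
  -- Pointwise comparison. If `x` and `f^[j] x` lie in a common ball, they are within `2 r`, so `x`
  -- is a close return. The cells whose balls contain `x` are disjoint subsets of `[x - r, x + r]`,
  -- so their total mass is at most `2 r S`.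
  by_cases hxE : x ∈ closeReturnSet X f j (2 * r)
  · simp only [hxE, Set.indicator_of_mem, Pi.one_apply, mul_one]
    classical
    calc _ ≤ ∑ i ∈ s with x ∈ B i, μ.real (cell (ε * r) i) := by
          rw [Finset.sum_filter]
          refine Finset.sum_le_sum fun i _ => ?_
          by_cases hxB : x ∈ B i
          · rw [if_pos hxB]
            refine mul_le_of_le_one_right measureReal_nonneg ?_
            exact Set.indicator_le_self' (by simp) x
          · rw [if_neg hxB]
            have : x ∉ B i ∩ f^[j] ⁻¹' B i := fun hh => hxB hh.1
            simp [this]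
      _ ≤ μ.real (Set.Icc (x - r) (x + r)) := by
          refine sum_measureReal_cell_le hδ _ fun i hi y hy => ?_
          have h1 := (Finset.mem_filter.1 hi).2
          have h2 := abs_sub_lt_of_mem_cell hδ hy
          rw [hBdef, Metric.mem_closedBall, Real.dist_eq] at h1
          rw [abs_le] at h1
          rw [abs_lt] at h2
          constructor <;> nlinarith
      _ ≤ S * (x + r - (x - r)) := hS _ _ (by linarith)
      _ = 2 * r * S := by ring
  · simp only [hxE, not_false_eq_true, Set.indicator_of_notMem, mul_zero]
    refine (Finset.sum_eq_zero fun i _ => ?_).le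
    have : x ∉ B i ∩ f^[j] ⁻¹' B i := by
      rintro ⟨h1, h2⟩
      refine hxE ⟨hx, ?_⟩
      rw [Set.mem_preimage] at h2
      rw [hBdef, Metric.mem_closedBall] at h1 h2
      have := dist_triangle_right x (f^[j] x) (i * (ε * r))
      nlinarith
    simp [this]

/-- Non-asymptotic bound for the probability of not returning close to the starting point. -/
theorem measure_noReturnSet_le (h : HyperbolicRecurrent X f μ ρ) {S : ℝ}
    (hS : ∀ a b : ℝ, a ≤ b → μ.real (Set.Icc a b) ≤ S * (b - a))
    {D : ℝ} (hD : 0 ≤ D) {q : ℕ} (hq : 1 ≤ q)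
    (hmix : ∀ I F : Set ℝ, I.OrdConnected → MeasurableSet F → ∀ j ≥ q,
      |μ.real (I ∩ f^[j] ⁻¹' F) - μ.real I * μ.real F| ≤ D * μ.real F)
    {ε r : ℝ} (hε : 0 < ε) (hr : 0 < r) {s : Finset ℤ}
    (hs : X ⊆ ⋃ i ∈ s, cell (ε * r) i) {p M n : ℕ} (hn : q + M * (p + q) ≤ n + 1) :
    μ (noReturnSet f n r) ≤
      ∫⁻ y, ENNReal.ofReal
        (Real.exp (-(M * p * μ.real (Metric.closedBall y ((1 - 2 * ε) * r))))) ∂μ +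
      ENNReal.ofReal (M * p * (D + 2 * r * S *
        ∑ j ∈ Finset.Icc 1 p, μ.real (closeReturnSet X f j (2 * r))) + s.card * D) := by
  have := h.isProbabilityMeasure
  have hf := h.measurePreserving
  have hδ : 0 < ε * r := mul_pos hε hr
  set I : ℤ → Set ℝ := cell (ε * r) with hIdef
  set B : ℤ → Set ℝ := fun i => Metric.closedBall (i * (ε * r)) ((1 - ε) * r) with hBdef
  have hIm : ∀ i, MeasurableSet (I i) := measurableSet_cell hδ
  have hBm : ∀ i, MeasurableSet (B i) := fun i => Metric.isClosed_closedBall.measurableSet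
  have hBo : ∀ i, (B i).OrdConnected := fun i => (convex_closedBall _ _).ordConnected
  have cellBound : ∀ i, μ.real (noReturnSet f n r ∩ I i) ≤
      μ.real (I i) * Real.exp (-(M * p * μ.real (B i))) +
        (M * p * (μ.real (I i) * D + μ.real (I i) * returnSum f μ (B i) p) + D) := by
    intro i
    set F := avoidSet f (B i) (M * (p + q))
    have hF : MeasurableSet F := measurableSet_avoidSet hf.measurable (hBm i) _
    -- Avoidance is imposed only from time `q` on. The condition `1 ≤ q` excludes the trivial time
    -- 0, and `hn` keeps every time `j + q` at most `n`.
    have h1 : noReturnSet f n r ∩ I i ⊆ I i ∩ f^[q] ⁻¹' F := by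
      rintro x ⟨hx, hxI⟩
      refine ⟨hxI, fun j hj hjB => ?_⟩
      rw [← Function.iterate_add_apply, hBdef, Metric.mem_closedBall] at hjB
      have h2 := hx (j + q) ⟨by omega, by omega⟩
      have h3 := abs_sub_lt_of_mem_cell hδ hxI
      rw [← Real.dist_eq] at h3
      have h4 := dist_triangle_right (f^[j + q] x) x (i * (ε * r))
      nlinarith
    have h2 := (abs_le.1 (hmix (I i) F (ordConnected_cell hδ i) hF q le_rfl)).2
    have h3 : μ.real F ≤ 1 := measureReal_le_one
    have h4 : μ.real F ≤ _ := measureReal_avoidSet_le hf (hBm i) hD (q := q)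
      (fun F hF j hj => by
        have := (abs_le.1 (hmix (B i) F (hBo i) hF j hj)).1
        linarith) p M
    have h5 : D * μ.real F ≤ D := mul_le_of_le_one_right hD h3
    have h6 := mul_le_mul_of_nonneg_left h4 (measureReal_nonneg (μ := μ) (s := I i))
    have h7 : μ.real (noReturnSet f n r ∩ I i) ≤ μ.real (I i ∩ f^[q] ⁻¹' F) :=
      measureReal_mono h1
    linarith
  have hsum1 : ∑ i ∈ s, μ.real (I i) ≤ 1 :=
    (sum_measureReal_cell_le hδ s fun i _ => Set.subset_univ _).trans measureReal_le_one
  have hsumR : ∑ i ∈ s, μ.real (I i) * returnSum f μ (B i) p ≤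
      2 * r * S * ∑ j ∈ Finset.Icc 1 p, μ.real (closeReturnSet X f j (2 * r)) := by
    simp only [returnSum, Finset.mul_sum]
    rw [Finset.sum_comm]
    exact Finset.sum_le_sum fun j _ => h.sum_cell_mul_measureReal_le hS hε hr s j
  have hcover : μ (noReturnSet f n r) ≤ ∑ i ∈ s, μ (noReturnSet f n r ∩ I i) := by
    calc μ (noReturnSet f n r) ≤ μ (⋃ i ∈ s, noReturnSet f n r ∩ I i) := by
          refine measure_mono_ae ?_
          filter_upwards [h.ae_mem] with x hx hxA
          have := hs hx
          simp only [Set.mem_iUnion] at this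
          obtain ⟨i, hi, hxi⟩ := this
          exact Set.mem_biUnion hi ⟨hxA, hxi⟩
      _ ≤ _ := measure_biUnion_finset_le _ _
  have hexp : ∑ i ∈ s, ENNReal.ofReal (μ.real (I i) * Real.exp (-(M * p * μ.real (B i)))) ≤
      ∫⁻ y, ENNReal.ofReal
        (Real.exp (-(M * p * μ.real (Metric.closedBall y ((1 - 2 * ε) * r))))) ∂μ := by
    calc _ ≤ ∑ i ∈ s, ∫⁻ y in I i, ENNReal.ofReal
          (Real.exp (-(M * p * μ.real (Metric.closedBall y ((1 - 2 * ε) * r))))) ∂μ := by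
          refine Finset.sum_le_sum fun i _ => ?_
          rw [ENNReal.ofReal_mul measureReal_nonneg, ofReal_measureReal, mul_comm,
            ← setLIntegral_const]
          refine setLIntegral_mono' (hIm i) fun y hy => ?_
          -- Shrinking the radius by another `ε r` fits a ball about any `y` of the cell inside `B
          -- i`; this turns the sum over cells into an integral.
          have hsub : Metric.closedBall y ((1 - 2 * ε) * r) ⊆ B i := by
            refine Metric.closedBall_subset_closedBall' ?_
            have h3 := abs_sub_lt_of_mem_cell hδ hy
            rw [← Real.dist_eq] at h3
            nlinarith
          have hle : μ.real (Metric.closedBall y ((1 - 2 * ε) * r)) ≤ μ.real (B i) :=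
            measureReal_mono hsub
          gcongr
      _ = ∫⁻ y in ⋃ i ∈ s, I i, ENNReal.ofReal
          (Real.exp (-(M * p * μ.real (Metric.closedBall y ((1 - 2 * ε) * r))))) ∂μ :=
          (lintegral_biUnion_finset (pairwiseDisjoint_cell _ _) (fun i _ => hIm i) _).symm
      _ ≤ _ := setLIntegral_le_lintegral _ _
  have hR0 : ∀ i, 0 ≤ returnSum f μ (B i) p := fun i => returnSum_nonneg p
  calc μ (noReturnSet f n r) ≤ ∑ i ∈ s, μ (noReturnSet f n r ∩ I i) := hcover
    _ ≤ ∑ i ∈ s, (ENNReal.ofReal (μ.real (I i) * Real.exp (-(M * p * μ.real (B i)))) +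
          ENNReal.ofReal
            (M * p * (μ.real (I i) * D + μ.real (I i) * returnSum f μ (B i) p) + D)) := by
        refine Finset.sum_le_sum fun i _ => ?_
        rw [← ENNReal.ofReal_add (by positivity)
          (by have := hR0 i; positivity), ← ofReal_measureReal]
        exact ENNReal.ofReal_le_ofReal (cellBound i)
    _ ≤ _ := by
        rw [Finset.sum_add_distrib]
        refine add_le_add hexp ?_
        rw [← ENNReal.ofReal_sum_of_nonneg fun i _ => by have := hR0 i; positivity]
        refine ENNReal.ofReal_le_ofReal ?_
        rw [Finset.sum_add_distrib, ← Finset.mul_sum, Finset.sum_add_distrib, ← Finset.sum_mul]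
        simp only [Finset.sum_const, nsmul_eq_mul]
        have : (∑ i ∈ s, μ.real (I i)) * D ≤ D := mul_le_of_le_one_left hD hsum1
        gcongr

end HyperbolicRecurrent

/-! ### Asymptotic form of the bound -/

theorem eventually_log_sq_le {a δ : ℝ} (ha : 0 < a) (hδ : 0 < δ) :
    ∀ᶠ n : ℕ in atTop, Real.log n ^ 2 ≤ δ * (n : ℝ) ^ a := by
  have h := (isLittleO_log_rpow_rpow_atTop 2 ha).bound hδ
  filter_upwards [tendsto_natCast_atTop_atTop.eventually h] with n hn
  rw [Real.norm_eq_abs, Real.norm_eq_abs, abs_of_nonneg (Real.rpow_nonneg (by positivity) a)] at hn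
  rw [← Real.rpow_natCast]
  exact (le_abs_self _).trans (by exact_mod_cast hn)

/-- Choice of block lengths: gaps of logarithmic size between blocks of squared-logarithmic size
which together fill almost all of `{1, …, n}`. -/
theorem eventually_exists_blocks {K ε : ℝ} (hK : 0 < K) (hε : 0 < ε) (hε1 : ε < 1) :
    ∀ᶠ n : ℕ in atTop, ∃ p q M : ℕ, (p : ℝ) ≤ Real.log n ^ 2 ∧ K * Real.log n ≤ q ∧ 1 ≤ q ∧
      q + M * (p + q) ≤ n + 1 ∧ (1 - ε) * n ≤ M * p ∧ (M * p : ℝ) ≤ n := by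
  have hL : Tendsto (fun n : ℕ => Real.log n) atTop atTop :=
    Real.tendsto_log_atTop.comp tendsto_natCast_atTop_atTop
  filter_upwards [hL.eventually_ge_atTop 2, hL.eventually_ge_atTop (4 / ε * (K + 3)),
    eventually_log_sq_le one_pos (show (0 : ℝ) < ε / 4 / (2 * K + 5) by positivity)]
    with n h1 h2 h3
  set L := Real.log n
  set p := ⌊L ^ 2⌋₊
  set q := ⌈K * L⌉₊ + 1
  have hp1 : (p : ℝ) ≤ L ^ 2 := Nat.floor_le (by positivity)
  have hp2 : L ^ 2 - 1 ≤ p := by have := Nat.lt_floor_add_one (L ^ 2); linarith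
  have hq1 : K * L ≤ q := by
    have := Nat.le_ceil (K * L)
    simp only [q]; push_cast; linarith
  have hq2 : (q : ℝ) ≤ K * L + 2 := by
    have := Nat.ceil_lt_add_one (show 0 ≤ K * L by positivity)
    simp only [q]; push_cast; linarith
  -- Gaps are linear in `log n` and blocks quadratic, so the gaps take a negligible share of time.
  have h4 : (q : ℝ) ≤ ε / 4 * p := by
    have : K + 3 ≤ ε / 4 * L := by
      have := mul_le_mul_of_nonneg_left h2 (show 0 ≤ ε / 4 by positivity)
      have e : ε / 4 * (4 / ε * (K + 3)) = K + 3 := by field_simp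
      linarith
    nlinarith
  have h5 : (p : ℝ) + 2 * q ≤ ε / 4 * n := by
    rw [Real.rpow_one, div_mul_eq_mul_div, le_div_iff₀ (by positivity)] at h3
    nlinarith
  have hqpos : 1 ≤ q := by simp [q]
  have hn0 : (0 : ℝ) ≤ n := Nat.cast_nonneg n
  have hqn : q ≤ n + 1 := by
    have : (q : ℝ) ≤ n := by nlinarith [(Nat.cast_nonneg p : (0 : ℝ) ≤ p)]
    have : q ≤ n := by exact_mod_cast this
    omega
  -- The largest number of block-gap pairs that fit after the initial gap; less than one pair is
  -- left over.
  set M := (n + 1 - q) / (p + q)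
  have hM1 : M * (p + q) ≤ n + 1 - q := Nat.div_mul_le_self _ _
  have hM2 : n + 1 - q < (M + 1) * (p + q) := by
    have := Nat.lt_div_mul_add (a := n + 1 - q) (show 0 < p + q by omega)
    simp only [M]; linarith
  have hM2' : n + 1 < (M + 1) * (p + q) + q := by omega
  have hM2'' : (n : ℝ) + 1 < (M + 1) * (p + q) + q := by exact_mod_cast hM2'
  have hM1' : q + M * (p + q) ≤ n + 1 := by omega
  have hM1'' : (q : ℝ) + M * (p + q) ≤ n + 1 := by exact_mod_cast hM1'
  have hq1' : (1 : ℝ) ≤ q := by exact_mod_cast hqpos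
  have hM0 : (0 : ℝ) ≤ M := Nat.cast_nonneg M
  refine ⟨p, q, M, hp1, hq1, hqpos, hM1', ?_, by nlinarith⟩
  have h6 : (M : ℝ) * q ≤ ε / 4 * (M * p) := by nlinarith
  have h7 : (1 - ε / 4) * n ≤ (1 + ε / 4) * (M * p) := by nlinarith
  have h8 : (1 - ε) * (1 + ε / 4) * n ≤ (1 - ε / 4) * n :=
    mul_le_mul_of_nonneg_right (by nlinarith) hn0
  have h9 : (1 + ε / 4) * ((1 - ε) * n) ≤ (1 + ε / 4) * (M * p) := by linarith
  exact le_of_mul_le_mul_left h9 (by positivity)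

theorem closeReturnSet_mono {X : Set ℝ} {f : ℝ → ℝ} {j : ℕ} {r r' : ℝ} (hr : r ≤ r') :
    closeReturnSet X f j r ⊆ closeReturnSet X f j r' :=
  fun _ hx => ⟨hx.1, hx.2.trans hr⟩

namespace HyperbolicRecurrent

variable {X : Set ℝ} {f : ℝ → ℝ} {μ : Measure ℝ} {ρ : ℝ → ℝ}

/-- The constants in (A2) depend on the sequence of radii. Fixing the single sequence `n^(-1/2)`
makes them uniform over all smaller radii, by monotonicity of the close-return sets. -/
theorem exists_closeReturn_bound (h : HyperbolicRecurrent X f μ ρ) :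
    ∃ β ∈ Set.Ioo (0 : ℝ) 1, ∃ C > (0 : ℝ), ∀ᶠ n : ℕ in atTop, ∀ j : ℕ, 1 ≤ j →
      (j : ℝ) ≤ Real.log n ^ 2 →
      μ.real (closeReturnSet X f j ((n : ℝ) ^ (-(1 / 2) : ℝ))) ≤ C * (n : ℝ) ^ (-(β / 2)) := by
  have hcomp : Comparable (fun n : ℕ => (n : ℝ) ^ (-(1 / 2) : ℝ))
      (fun n : ℕ => (n : ℝ) ^ (-(1 / 2) : ℝ)) := by
    refine ⟨2, by norm_num, ?_⟩
    filter_upwards [eventually_ge_atTop 1] with n hn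
    have : (0 : ℝ) < n := by exact_mod_cast hn
    rw [div_self (Real.rpow_pos_of_pos this _).ne']
    norm_num
  obtain ⟨β, hβ, C, hC, H⟩ := h.shortRecurrence (1 / 2) (by norm_num) _ hcomp
  refine ⟨β, hβ, C, hC, H.mono fun n hn j hj1 hj2 => (hn j hj1 hj2).trans_eq ?_⟩
  rw [← Real.rpow_mul (Nat.cast_nonneg n)]
  congr 2; ring

/-- Uniformly in the radius, the probability of not returning close to the starting point is at
most that predicted by an exponential law, up to a polynomially small error. -/
theorem exists_noReturn_bound (h : HyperbolicRecurrent X f μ ρ) {ε : ℝ} (hε : 0 < ε)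
    (hε1 : ε < 1) :
    ∃ κ > (0 : ℝ), ∃ C > (0 : ℝ), ∀ᶠ n : ℕ in atTop, ∀ r : ℝ, (n : ℝ) ^ (-2 : ℝ) ≤ r →
      r ≤ (n : ℝ) ^ (-1 + κ) → μ (noReturnSet f n r) ≤
        ∫⁻ y, ENNReal.ofReal
          (Real.exp (-((1 - ε) * n * μ.real (Metric.closedBall y ((1 - ε) * r))))) ∂μ +
        ENNReal.ofReal (C * (n : ℝ) ^ (-κ)) := by
  have := h.isProbabilityMeasure
  obtain ⟨C₁, hC₁, c, hc, hdec⟩ := h.exists_decay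
  obtain ⟨S, hS0, hS⟩ := h.exists_measureReal_Icc_le
  obtain ⟨Λ, hΛ, hcell⟩ := exists_finset_cells h.isBounded
  obtain ⟨β, hβ, C₂, hC₂, hshort⟩ := h.exists_closeReturn_bound
  have hβ0 := hβ.1
  have hβ1 := hβ.2
  -- The three summands of the constant bound the mixing error within blocks, the short returns, and
  -- the mixing error of the cells.
  refine ⟨β / 8, by positivity, C₁ + 2 * S * C₂ + (2 * Λ / ε + 2) * C₁, by positivity, ?_⟩
  have hhalf : ∀ᶠ n : ℕ in atTop, 2 * (n : ℝ) ^ (-1 + β / 8) ≤ (n : ℝ) ^ (-(1 / 2) : ℝ) := by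
    have ht := (tendsto_rpow_atTop (show (0 : ℝ) < 1 / 2 - β / 8 by linarith)).comp
      tendsto_natCast_atTop_atTop
    filter_upwards [ht.eventually_ge_atTop 2, eventually_ge_atTop 1] with n hn hn1
    have hn0 : (0 : ℝ) < n := by exact_mod_cast hn1
    calc 2 * (n : ℝ) ^ (-1 + β / 8) ≤ (n : ℝ) ^ (1 / 2 - β / 8) * (n : ℝ) ^ (-1 + β / 8) := by
          gcongr; exact hn
      _ = _ := by rw [← Real.rpow_add hn0]; congr 1; ring
  -- A gap of at least `(4 / c) log n` makes the mixing error `O(n^(-4))`, which beats both the `n`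
  -- time steps and the `O(n²)` cells; the cell count is where `r ≥ n^(-2)` enters.
  filter_upwards [hshort, hhalf, eventually_exists_blocks (show 0 < 4 / c by positivity) hε hε1,
    eventually_log_sq_le (show 0 < β / 8 by positivity) one_pos, eventually_ge_atTop 1]
    with n hE h2r hpq hlog hn1 r hr1 hr2
  obtain ⟨p, q, M, hp, hq, hq1, hMn, hMp, hMp'⟩ := hpq
  have hn1' : (1 : ℝ) ≤ n := by exact_mod_cast hn1
  have hn0 : (0 : ℝ) < n := by linarith
  have hr : 0 < r := (Real.rpow_pos_of_pos hn0 _).trans_le hr1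
  set D := C₁ * Real.exp (-c * q) with hDdef
  have hD0 : 0 ≤ D := by positivity
  have hD : D ≤ C₁ * (n : ℝ) ^ (-4 : ℝ) := by
    rw [Real.rpow_def_of_pos hn0, hDdef]
    refine mul_le_mul_of_nonneg_left (Real.exp_le_exp.2 ?_) hC₁.le
    have := mul_le_mul_of_nonneg_left hq hc.le
    have e : c * (4 / c * Real.log n) = 4 * Real.log n := by field_simp
    linarith
  obtain ⟨s, hscard, hs⟩ := hcell (ε / 2 * r) (by positivity)
  have key := h.measure_noReturnSet_le hS hD0 hq1
    (fun I F hI hF j hj => (hdec I F hI hF j).trans (by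
      have : (q : ℝ) ≤ j := by exact_mod_cast hj
      refine mul_le_mul_of_nonneg_right ?_ measureReal_nonneg
      rw [hDdef]
      refine mul_le_mul_of_nonneg_left (Real.exp_le_exp.2 ?_) hC₁.le
      nlinarith))
    (half_pos hε) hr hs hMn
  refine key.trans (add_le_add (lintegral_mono fun y => ?_) (ENNReal.ofReal_le_ofReal ?_))
  · rw [show (1 - 2 * (ε / 2)) = 1 - ε by ring]
    gcongr
  · have hnκ : ∀ t : ℝ, t ≤ -(β / 8) → (n : ℝ) ^ t ≤ (n : ℝ) ^ (-(β / 8)) :=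
      fun t ht => Real.rpow_le_rpow_of_exponent_le hn1' ht
    have b1 : M * p * D ≤ C₁ * (n : ℝ) ^ (-(β / 8)) := by
      calc M * p * D ≤ n * (C₁ * (n : ℝ) ^ (-4 : ℝ)) := by gcongr
        _ = C₁ * ((n : ℝ) ^ (1 : ℝ) * (n : ℝ) ^ (-4 : ℝ)) := by rw [Real.rpow_one]; ring
        _ = C₁ * (n : ℝ) ^ (1 + -4 : ℝ) := by rw [Real.rpow_add hn0]
        _ ≤ _ := mul_le_mul_of_nonneg_left (hnκ _ (by linarith)) (by positivity)
    -- The exponents `1`, `-1 + β/8`, `β/8` and `-β/2` come from time, radius, block length and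
    -- (A2); they add up to `-β/4`.
    have b2 : M * p * (2 * r * S * ∑ j ∈ Finset.Icc 1 p,
        μ.real (closeReturnSet X f j (2 * r))) ≤ 2 * S * C₂ * (n : ℝ) ^ (-(β / 8)) := by
      have hsum : ∑ j ∈ Finset.Icc 1 p, μ.real (closeReturnSet X f j (2 * r)) ≤
          (n : ℝ) ^ (β / 8) * (C₂ * (n : ℝ) ^ (-(β / 2))) := by
        calc _ ≤ ∑ j ∈ Finset.Icc 1 p, C₂ * (n : ℝ) ^ (-(β / 2)) := by
              refine Finset.sum_le_sum fun j hj => ?_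
              rw [Finset.mem_Icc] at hj
              have hjp : (j : ℝ) ≤ p := by exact_mod_cast hj.2
              exact (measureReal_mono (closeReturnSet_mono (by linarith))).trans
                (hE j hj.1 (hjp.trans hp))
          _ = p * (C₂ * (n : ℝ) ^ (-(β / 2))) := by simp
          _ ≤ _ := by gcongr; linarith
      calc _ ≤ n * (2 * (n : ℝ) ^ (-1 + β / 8) * S *
            ((n : ℝ) ^ (β / 8) * (C₂ * (n : ℝ) ^ (-(β / 2))))) := by gcongr
        _ = 2 * S * C₂ * ((n : ℝ) ^ (1 : ℝ) * (n : ℝ) ^ (-1 + β / 8) * (n : ℝ) ^ (β / 8) *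
            (n : ℝ) ^ (-(β / 2))) := by rw [Real.rpow_one]; ring
        _ = 2 * S * C₂ * (n : ℝ) ^ (1 + (-1 + β / 8) + β / 8 + -(β / 2)) := by
            rw [← Real.rpow_add hn0, ← Real.rpow_add hn0, ← Real.rpow_add hn0]
        _ ≤ _ := mul_le_mul_of_nonneg_left (hnκ _ (by linarith)) (by positivity)
    have b3 : s.card * D ≤ (2 * Λ / ε + 2) * C₁ * (n : ℝ) ^ (-(β / 8)) := by
      have hinv : r⁻¹ ≤ (n : ℝ) ^ (2 : ℝ) := by
        rw [show (2 : ℝ) = - -2 by ring, Real.rpow_neg hn0.le]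
        exact inv_anti₀ (Real.rpow_pos_of_pos hn0 _) hr1
      have hcard : (s.card : ℝ) ≤ (2 * Λ / ε + 2) * (n : ℝ) ^ (2 : ℝ) := by
        have h1 : (1 : ℝ) ≤ (n : ℝ) ^ (2 : ℝ) := Real.one_le_rpow hn1' (by norm_num)
        have e : Λ / (ε / 2 * r) = 2 * Λ / ε * r⁻¹ := by field_simp
        have : 2 * Λ / ε * r⁻¹ ≤ 2 * Λ / ε * (n : ℝ) ^ (2 : ℝ) := by gcongr
        linarith
      calc s.card * D ≤ (2 * Λ / ε + 2) * (n : ℝ) ^ (2 : ℝ) * (C₁ * (n : ℝ) ^ (-4 : ℝ)) := by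
            gcongr
        _ = (2 * Λ / ε + 2) * C₁ * ((n : ℝ) ^ (2 : ℝ) * (n : ℝ) ^ (-4 : ℝ)) := by ring
        _ = (2 * Λ / ε + 2) * C₁ * (n : ℝ) ^ (2 + -4 : ℝ) := by rw [Real.rpow_add hn0]
        _ ≤ _ := mul_le_mul_of_nonneg_left (hnκ _ (by linarith)) (by positivity)
    linarith

end HyperbolicRecurrent

/-! ### Almost sure upper bounds -/

theorem ae_eventually_notMem_of_eventually_le {μ : Measure ℝ} {s : ℕ → Set ℝ} {u : ℕ → ℝ}
    (hu : Summable u) (h : ∀ᶠ k in atTop, μ (s k) ≤ ENNReal.ofReal (u k)) :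
    ∀ᵐ x ∂μ, ∀ᶠ k in atTop, x ∉ s k := by
  obtain ⟨K, hK⟩ := eventually_atTop.1 h
  have hne : ∑' k, μ (s (k + K)) ≠ ⊤ := by
    refine ne_top_of_le_ne_top ((summable_nat_add_iff K).2 hu).tsum_ofReal_ne_top ?_
    exact ENNReal.tsum_le_tsum fun k => hK _ (by omega)
  filter_upwards [ae_eventually_notMem hne] with x hx
  rw [← map_add_atTop_eq_nat K]
  exact hx

theorem eventually_pow_le_const_mul_pow (A : ℕ) {a δ : ℝ} (ha : 1 < a) (hδ : 0 < δ) :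
    ∀ᶠ k : ℕ in atTop, (k : ℝ) ^ A ≤ δ * a ^ k := by
  have h := tendsto_pow_const_div_const_pow_of_one_lt A ha
  filter_upwards [h.eventually (gt_mem_nhds hδ)] with k hk
  exact ((div_lt_iff₀ (pow_pos (by linarith) k)).1 hk).le

theorem eventually_le_floor_pow {ε θ : ℝ} (hε : 0 < ε) (hθ : 1 < θ) :
    ∀ᶠ k : ℕ in atTop, (1 - ε) * θ ^ k ≤ ⌊θ ^ k⌋₊ := by
  filter_upwards [(tendsto_pow_atTop_atTop_of_one_lt hθ).eventually_ge_atTop (1 / ε)] with k hk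
  have h1 := Nat.lt_floor_add_one (θ ^ k)
  have h2 : 1 ≤ ε * θ ^ k := by
    rw [div_le_iff₀ hε] at hk; linarith
  linarith

/-- Every large `n` lies between two consecutive large powers of `θ`. -/
theorem eventually_exists_pow_near {θ : ℝ} (hθ : 1 < θ) {P : ℕ → Prop}
    (hP : ∀ᶠ k in atTop, P k) :
    ∀ᶠ n : ℕ in atTop, ∃ k, P k ∧ θ ^ k ≤ n ∧ (n : ℝ) < θ ^ (k + 1) := by
  obtain ⟨K, hK⟩ := eventually_atTop.1 hP
  filter_upwards [eventually_ge_atTop 1,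
    (tendsto_natCast_atTop_atTop (R := ℝ)).eventually_ge_atTop (θ ^ K)] with n hn1 hn2
  obtain ⟨k, hk1, hk2⟩ := exists_nat_pow_near (x := (n : ℝ)) (by exact_mod_cast hn1) hθ
  refine ⟨k, hK k ?_, hk1, hk2⟩
  have := (pow_lt_pow_iff_right₀ hθ).1 (hn2.trans_lt hk2)
  omega

theorem minReturnDist_le {f : ℝ → ℝ} {n j : ℕ} (x : ℝ) (hj : j ∈ Set.Icc 1 n) :
    minReturnDist f n x ≤ dist (f^[j] x) x := by
  refine csInf_le ⟨0, ?_⟩ ⟨j, hj, rfl⟩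
  rintro _ ⟨k, _, rfl⟩
  exact dist_nonneg

/-- Passing from returns up to geometrically growing times to all times. -/
theorem ae_eventually_minReturnDist_lt {f : ℝ → ℝ} {μ : Measure ℝ} {θ : ℝ} (hθ : 1 < θ)
    {R r : ℕ → ℝ} (hR : ∀ᵐ x ∂μ, ∀ᶠ k in atTop, x ∉ noReturnSet f ⌊θ ^ k⌋₊ (R k))
    (hRr : ∀ᶠ k : ℕ in atTop, ∀ n : ℕ, θ ^ k ≤ n → (n : ℝ) < θ ^ (k + 1) → R k ≤ r n) :
    ∀ᵐ x ∂μ, ∀ᶠ n in atTop, minReturnDist f n x < r n := by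
  filter_upwards [hR] with x hx
  filter_upwards [eventually_exists_pow_near hθ (hx.and hRr)] with n hn
  obtain ⟨k, ⟨h1, h2⟩, h3, h4⟩ := hn
  simp only [noReturnSet, Set.mem_ofPred_eq, not_forall, not_le] at h1
  obtain ⟨j, hj, hlt⟩ := h1
  refine (minReturnDist_le x ⟨hj.1, hj.2.trans ?_⟩).trans_lt (hlt.trans_le (h2 n h3 h4))
  exact Nat.floor_le_of_le h3

namespace HyperbolicRecurrent

variable {X : Set ℝ} {f : ℝ → ℝ} {μ : Measure ℝ} {ρ : ℝ → ℝ}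

/-- Points close to the boundary of `X` are negligible in the bound by an exponential law. -/
theorem lintegral_exp_neg_le (h : HyperbolicRecurrent X f μ ρ) {S : ℝ}
    (hS : ∀ a b : ℝ, a ≤ b → μ.real (Set.Icc a b) ≤ S * (b - a)) {R : ℝ} (hR : 0 ≤ R)
    {g G : ℝ → ℝ} (hg : ∀ y, 0 ≤ g y)
    (hG : ∀ y ∈ X, Metric.closedBall y R ⊆ X → G y ≤ g y) :
    ∫⁻ y, ENNReal.ofReal (Real.exp (-g y)) ∂μ ≤
      ∫⁻ y, ENNReal.ofReal (Real.exp (-G y)) ∂μ + ENNReal.ofReal (2 * S * R) := by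
  have := h.isProbabilityMeasure
  set a := sInf X
  set b := sSup X
  set E := Set.Icc a (a + R) ∪ Set.Icc (b - R) b
  have hE : MeasurableSet E := measurableSet_Icc.union measurableSet_Icc
  have hEμ : μ E ≤ ENNReal.ofReal (2 * S * R) := by
    rw [← ofReal_measureReal]
    refine ENNReal.ofReal_le_ofReal ((measureReal_union_le _ _).trans ?_)
    have h1 := hS a (a + R) (by linarith)
    have h2 := hS (b - R) b (by linarith)
    linarith
  calc _ ≤ ∫⁻ y, (ENNReal.ofReal (Real.exp (-G y)) + E.indicator 1 y) ∂μ := by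
        refine lintegral_mono_ae ?_
        filter_upwards [h.ae_mem] with y hy
        -- Within `R` of an endpoint of `X` the integrand is bounded by 1; elsewhere the ball lies
        -- in `X` and the lower bound `G` applies.
        by_cases hyE : y ∈ E
        · rw [Set.indicator_of_mem hyE]
          refine le_add_left ?_
          rw [Pi.one_apply, ENNReal.ofReal_le_one, Real.exp_le_one_iff]
          linarith [hg y]
        · refine le_add_right (ENNReal.ofReal_le_ofReal (Real.exp_le_exp.2 ?_))
          refine neg_le_neg (hG y hy fun x hx => ?_)
          have hya : a ≤ y := csInf_le h.isBounded.bddBelow hy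
          have hyb : y ≤ b := le_csSup h.isBounded.bddAbove hy
          have h1 : a < y - R := by
            by_contra hc
            exact hyE (Or.inl ⟨hya, by linarith⟩)
          have h2 : y + R < b := by
            by_contra hc
            exact hyE (Or.inr ⟨by linarith, hyb⟩)
          obtain ⟨x₁, hx₁, hx₁'⟩ := exists_lt_of_csInf_lt h.nonempty h1
          obtain ⟨x₂, hx₂, hx₂'⟩ := exists_lt_of_lt_csSup h.nonempty h2
          rw [Real.closedBall_eq_Icc] at hx
          exact h.ordConnected.out hx₁ hx₂ ⟨by linarith [hx.1], by linarith [hx.2]⟩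
    _ = ∫⁻ y, ENNReal.ofReal (Real.exp (-G y)) ∂μ + μ E := by
        rw [lintegral_add_right _ (measurable_one.indicator hE), lintegral_indicator_one hE]
    _ ≤ _ := add_le_add le_rfl hEμ

/-- A Borel–Cantelli argument for returns up to time `θ ^ k` to within distance `g k / θ ^ k`. -/
theorem ae_eventually_notMem_noReturnSet (h : HyperbolicRecurrent X f μ ρ) {ε θ : ℝ}
    (hε : 0 < ε) (hε1 : ε < 1) (hθ : 1 < θ) {g : ℕ → ℝ} {A : ℕ}
    (hg : ∀ᶠ k : ℕ in atTop, ((k : ℝ) ^ A)⁻¹ ≤ g k ∧ g k ≤ (k : ℝ) ^ A)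
    {G : ℕ → ℝ → ℝ} {u : ℕ → ℝ} (hu : Summable u)
    (hG : ∀ᶠ k : ℕ in atTop, ∀ y ∈ X, Metric.closedBall y (g k / θ ^ k) ⊆ X →
      G k y ≤ (1 - ε) * ⌊θ ^ k⌋₊ * μ.real (Metric.closedBall y ((1 - ε) * (g k / θ ^ k))))
    (hle : ∀ᶠ k : ℕ in atTop, ∫⁻ y, ENNReal.ofReal (Real.exp (-G k y)) ∂μ ≤
      ENNReal.ofReal (u k)) :
    ∀ᵐ x ∂μ, ∀ᶠ k in atTop, x ∉ noReturnSet f ⌊θ ^ k⌋₊ (g k / θ ^ k) := by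
  have := h.isProbabilityMeasure
  obtain ⟨S, hS0, hS⟩ := h.exists_measureReal_Icc_le
  obtain ⟨κ, hκ, C, hC, hbound⟩ := h.exists_noReturn_bound hε hε1
  have hθ0 : 0 < θ := by linarith
  have hNtop : Tendsto (fun k : ℕ => ⌊θ ^ k⌋₊) atTop atTop :=
    tendsto_nat_floor_atTop.comp (tendsto_pow_atTop_atTop_of_one_lt hθ)
  set a := θ ^ (-κ) with ha
  have ha0 : 0 < a := Real.rpow_pos_of_pos hθ0 _
  have ha1 : a < 1 := Real.rpow_lt_one_of_one_lt_of_neg hθ (by linarith)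
  have hak : ∀ k : ℕ, (θ ^ k) ^ (-κ) = a ^ k := fun k => by
    rw [ha, ← Real.rpow_natCast, ← Real.rpow_natCast, ← Real.rpow_mul hθ0.le,
      ← Real.rpow_mul hθ0.le, mul_comm]
  -- The three terms are the main integral, the boundary layer of width `g k / θ ^ k`, and the
  -- polynomial error, which is geometric along `θ ^ k`.
  have hsum : Summable fun k : ℕ => |u k| + (2 * S * ((k : ℝ) ^ A * (θ⁻¹) ^ k) +
      C * ((1 / 2) ^ (-κ) * a ^ k)) := by
    refine hu.abs.add (Summable.add (Summable.mul_left _ ?_) ?_)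
    · refine summable_pow_mul_geometric_of_norm_lt_one A ?_
      rw [Real.norm_of_nonneg (by positivity)]
      exact inv_lt_one_of_one_lt₀ hθ
    · exact ((summable_geometric_of_lt_one ha0.le ha1).mul_left _).mul_left _
  refine ae_eventually_notMem_of_eventually_le hsum ?_
  filter_upwards [hNtop.eventually hbound, hg, hG, hle, eventually_le_floor_pow one_half_pos hθ,
    eventually_pow_le_const_mul_pow A hθ (show (0 : ℝ) < 1 / 4 by norm_num),
    eventually_pow_le_const_mul_pow A (one_lt_inv_iff₀.2 ⟨ha0, ha1⟩) one_pos,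
    eventually_pow_le_const_mul_pow A hθ one_pos, eventually_ge_atTop 1]
    with k hb hgk hGk hlek hN h4 hκk h1k hk1
  have hk0 : (0 : ℝ) < k := by exact_mod_cast hk1
  have hkA : (0 : ℝ) < (k : ℝ) ^ A := by positivity
  have hθk : 0 < θ ^ k := by positivity
  have hθk1 : 1 ≤ θ ^ k := one_le_pow₀ hθ.le
  have hNle : (⌊θ ^ k⌋₊ : ℝ) ≤ θ ^ k := Nat.floor_le hθk.le
  set N : ℝ := (⌊θ ^ k⌋₊ : ℝ) with hNdef
  have hN0 : 0 < N := by nlinarith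
  have hN1 : 1 ≤ N := by
    have : 1 ≤ ⌊θ ^ k⌋₊ := Nat.le_floor (by simpa using hθk1)
    rw [hNdef]; exact_mod_cast this
  have hg0 : 0 < g k := (inv_pos.2 hkA).trans_le hgk.1
  have hR0 : 0 < g k / θ ^ k := by positivity
  have hlow : N ^ (-2 : ℝ) ≤ g k / θ ^ k := by
    rw [Real.rpow_neg hN0.le, show (2 : ℝ) = (2 : ℕ) by norm_num, Real.rpow_natCast]
    have h5 : θ ^ k * (k : ℝ) ^ A ≤ N ^ 2 := by nlinarith
    calc (N ^ 2)⁻¹ ≤ (θ ^ k * (k : ℝ) ^ A)⁻¹ := inv_anti₀ (by positivity) h5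
      _ = ((k : ℝ) ^ A)⁻¹ / θ ^ k := by rw [mul_inv, mul_comm]; rfl
      _ ≤ _ := by gcongr; exact hgk.1
  have hRle : g k / θ ^ k ≤ (k : ℝ) ^ A * (θ⁻¹) ^ k := by
    rw [inv_pow, ← div_eq_mul_inv]
    gcongr; exact hgk.2
  have hup : g k / θ ^ k ≤ N ^ (-1 + κ) := by
    -- The sign of the exponent `-1 + κ` decides whether passing from `θ ^ k` to its floor helps;
    -- for `κ > 1` the right side is at least 1.
    rcases le_or_gt κ 1 with hκ1 | hκ1
    · calc g k / θ ^ k ≤ (a⁻¹) ^ k / θ ^ k := by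
            gcongr; linarith [hgk.2]
        _ = (θ ^ k) ^ (-1 + κ) := by
            rw [Real.rpow_add hθk, Real.rpow_neg_one, inv_pow, ← hak, Real.rpow_neg hθk.le,
              inv_inv, div_eq_mul_inv, mul_comm]
        _ ≤ N ^ (-1 + κ) := Real.rpow_le_rpow_of_nonpos hN0 hNle (by linarith)
    · calc g k / θ ^ k ≤ 1 := by
            rw [div_le_one hθk]; linarith [hgk.2]
        _ ≤ N ^ (-1 + κ) := Real.one_le_rpow hN1 (by linarith)
  have hNκ : N ^ (-κ) ≤ (1 / 2) ^ (-κ) * a ^ k := by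
    rw [← hak, ← Real.mul_rpow (by norm_num) hθk.le]
    exact Real.rpow_le_rpow_of_nonpos (by positivity) (by linarith) (by linarith)
  have hint := h.lintegral_exp_neg_le hS hR0.le (G := G k)
    (g := fun y => (1 - ε) * N * μ.real (Metric.closedBall y ((1 - ε) * (g k / θ ^ k))))
    (fun y => mul_nonneg (mul_nonneg (by linarith) hN0.le) measureReal_nonneg) hGk
  calc μ (noReturnSet f ⌊θ ^ k⌋₊ (g k / θ ^ k))
      ≤ _ := hb _ hlow hup
    _ ≤ (ENNReal.ofReal (u k) + ENNReal.ofReal (2 * S * (g k / θ ^ k))) +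
        ENNReal.ofReal (C * N ^ (-κ)) :=
        add_le_add (hint.trans (add_le_add hlek le_rfl)) le_rfl
    _ ≤ (ENNReal.ofReal |u k| + ENNReal.ofReal (2 * S * ((k : ℝ) ^ A * (θ⁻¹) ^ k))) +
        ENNReal.ofReal (C * ((1 / 2) ^ (-κ) * a ^ k)) := by
        gcongr; exact le_abs_self _
    _ = _ := by
        rw [← ENNReal.ofReal_add (by positivity) (by positivity),
          ← ENNReal.ofReal_add (by positivity) (by positivity), add_assoc]

end HyperbolicRecurrent

theorem exists_pos_le_rpow (γ : ℝ) {a b : ℝ} (ha : 0 < a) :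
    ∃ m > (0 : ℝ), ∀ x ∈ Set.Icc a b, m ≤ x ^ γ := by
  rcases le_or_gt 0 γ with h | h
  · exact ⟨a ^ γ, Real.rpow_pos_of_pos ha _, fun x hx => Real.rpow_le_rpow ha.le hx.1 h⟩
  · rcases le_or_gt a b with hab | hab
    · exact ⟨b ^ γ, Real.rpow_pos_of_pos (ha.trans_le hab) _, fun x hx =>
        Real.rpow_le_rpow_of_nonpos (ha.trans_le hx.1) hx.2 h.le⟩
    · exact ⟨1, one_pos, fun x hx => absurd (hx.1.trans hx.2) hab.not_ge⟩

/-- Comparison of `(log n)^γ / (2n)` with its values along powers of two. -/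
theorem exists_le_log_rpow_div {γ γ₀ : ℝ} (hγ : γ₀ ≤ γ) :
    ∃ m > (0 : ℝ), ∀ k n : ℕ, 1 ≤ k → (2 : ℝ) ^ k ≤ n → (n : ℝ) < 2 ^ (k + 1) →
      m * (k : ℝ) ^ γ₀ / 2 ^ k ≤ Real.log n ^ γ / (2 * n) := by
  have hlog2 : 0 < Real.log 2 := Real.log_pos one_lt_two
  obtain ⟨m, hm, hmle⟩ := exists_pos_le_rpow γ (b := 2 * Real.log 2) hlog2
  refine ⟨m / 4, by positivity, fun k n hk h1 h2 => ?_⟩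
  have hk1 : (1 : ℝ) ≤ k := by exact_mod_cast hk
  have hk0 : (0 : ℝ) < k := by linarith
  have h2k : (0 : ℝ) < 2 ^ k := by positivity
  have hn0 : (0 : ℝ) < n := h2k.trans_le h1
  have l1 : k * Real.log 2 ≤ Real.log n := by
    rw [← Real.log_pow]; exact Real.log_le_log h2k h1
  have l2 : Real.log n ≤ (k + 1 : ℕ) * Real.log 2 := by
    rw [← Real.log_pow]; exact Real.log_le_log hn0 h2.le
  push_cast at l2
  -- The ratio stays in a compact subset of `(0, ∞)`, so its `γ`-th power is bounded below whatever
  -- the sign of `γ`.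
  have hmem : Real.log n / k ∈ Set.Icc (Real.log 2) (2 * Real.log 2) := by
    constructor
    · rw [le_div_iff₀ hk0]; linarith
    · rw [div_le_iff₀ hk0]; nlinarith
  have hpow : m * (k : ℝ) ^ γ₀ ≤ Real.log n ^ γ := by
    calc m * (k : ℝ) ^ γ₀ ≤ (Real.log n / k) ^ γ * (k : ℝ) ^ γ := by
          gcongr
          exact hmle _ hmem
      _ = Real.log n ^ γ := by
          rw [← Real.mul_rpow (hlog2.le.trans hmem.1) hk0.le, div_mul_cancel₀ _ hk0.ne']
  rw [pow_succ] at h2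
  calc m / 4 * (k : ℝ) ^ γ₀ / 2 ^ k = m * (k : ℝ) ^ γ₀ / (2 * (2 ^ k * 2)) := by
        field_simp; norm_num
    _ ≤ _ := by gcongr

namespace HyperbolicRecurrent

variable {X : Set ℝ} {f : ℝ → ℝ} {μ : Measure ℝ} {ρ : ℝ → ℝ}

/-- Almost sure upper bound for a density bounded away from zero. -/
theorem ae_eventually_minReturnDist_lt_of_pos (h : HyperbolicRecurrent X f μ ρ) {c : ℝ}
    {r : ℕ → ℝ} (hρ : ∀ x ∈ X, 0 < ρ x) (hc : 1 < 2 * c * sInf (ρ '' X))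
    (hr : ∀ᶠ n : ℕ in atTop, c * Real.log (Real.log n) / n < r n) :
    ∀ᵐ x ∂μ, ∀ᶠ n : ℕ in atTop, minReturnDist f n x < r n := by
  have := h.isProbabilityMeasure
  set m := sInf (ρ '' X)
  have hbdd : BddBelow (ρ '' X) := ⟨0, by rintro _ ⟨x, hx, rfl⟩; exact (hρ x hx).le⟩
  have hm : ∀ x ∈ X, m ≤ ρ x := fun x hx => csInf_le hbdd ⟨x, hx, rfl⟩
  have hm0 : 0 ≤ m := Real.sInf_nonneg (by rintro _ ⟨x, hx, rfl⟩; exact (hρ x hx).le)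
  have hc0 : 0 < c := by
    by_contra hneg
    nlinarith [mul_nonneg (sub_nonneg.2 (not_lt.1 hneg)) hm0]
  have hm0 : 0 < m := hm0.lt_of_ne (by rintro h0; rw [← h0] at hc; norm_num at hc)
  have hcm : 0 < c * m := by positivity
  -- Four factors `1 - ε` are lost: in the exponential law, in the radius, in the floor, and in the
  -- spacing of the times. This `ε` gives `2 c m (1 - 4 ε) = c m + 1/2 > 1`, so the exponent `t`
  -- still exceeds 1.
  set ε := (1 - 1 / (2 * c * m)) / 8 with hεdef
  have hinv : 1 / (2 * c * m) < 1 := by rw [div_lt_one (by positivity)]; exact hc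
  have hinv0 : 0 < 1 / (2 * c * m) := by positivity
  have hε : 0 < ε := by simp only [ε]; linarith
  have hε1 : ε < 1 / 8 := by simp only [ε]; linarith
  set θ := (1 - ε)⁻¹ with hθdef
  have h1ε : 0 < 1 - ε := by linarith
  have hθ : 1 < θ := one_lt_inv_iff₀.2 ⟨h1ε, by linarith⟩
  have hθinv : θ⁻¹ = 1 - ε := inv_inv _
  have hθ0 : 0 < θ := by linarith
  set t := 2 * c * m * (1 - ε) ^ 4 with htdef
  have ht : 1 < t := by
    have h4 : 1 - 4 * ε ≤ (1 - ε) ^ 4 := by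
      nlinarith [sq_nonneg ε, sq_nonneg (ε ^ 2 - 2 * ε), mul_pos hε hε]
    have e : 2 * c * m * (1 - 4 * ε) = c * m + 1 / 2 := by
      simp only [ε]; field_simp; ring
    have : 2 * c * m * (1 - 4 * ε) ≤ t := mul_le_mul_of_nonneg_left h4 (by positivity)
    linarith
  set l := Real.log θ with hl
  have hl0 : 0 < l := Real.log_pos hθ
  -- Here `k * l = log (θ ^ k)` and `1 - ε = θ⁻¹`, so `g k / θ ^ k = c log log (θ ^ k) / θ ^ (k +
  -- 1)`, which is below `c log log n / n` for `θ ^ k ≤ n < θ ^ (k + 1)`.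
  set g : ℕ → ℝ := fun k => c * (1 - ε) * Real.log (k * l) with hgdef
  have hkl : Tendsto (fun k : ℕ => (k : ℝ) * l) atTop atTop :=
    tendsto_natCast_atTop_atTop.atTop_mul_const hl0
  have hloginf : Tendsto (fun k : ℕ => Real.log (k * l)) atTop atTop :=
    Real.tendsto_log_atTop.comp hkl
  have hg : ∀ᶠ k : ℕ in atTop, ((k : ℝ) ^ 2)⁻¹ ≤ g k ∧ g k ≤ (k : ℝ) ^ 2 := by
    filter_upwards [hloginf.eventually_ge_atTop (1 / (c * (1 - ε))), eventually_ge_atTop 1,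
      (tendsto_natCast_atTop_atTop (R := ℝ)).eventually_ge_atTop (c * (1 - ε) * l)]
      with k hk1 hk2 hk3
    have hk2' : (1 : ℝ) ≤ k := by exact_mod_cast hk2
    rw [div_le_iff₀ (by positivity)] at hk1
    have hlog : Real.log (k * l) ≤ k * l := Real.log_le_self (by positivity)
    constructor
    · calc ((k : ℝ) ^ 2)⁻¹ ≤ 1 := inv_le_one_of_one_le₀ (one_le_pow₀ hk2')
        _ ≤ g k := by simp only [g]; linarith
    · calc g k ≤ c * (1 - ε) * (k * l) := mul_le_mul_of_nonneg_left hlog (by positivity)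
        _ = k * (c * (1 - ε) * l) := by ring
        _ ≤ k * k := by gcongr
        _ = _ := by ring
  refine ae_eventually_minReturnDist_lt hθ (R := fun k => g k / θ ^ k)
    (h.ae_eventually_notMem_noReturnSet hε (by linarith) hθ hg
      (G := fun k _ => t * Real.log (k * l)) (u := fun k => (k : ℝ) ^ (-t) * l ^ (-t)) ?_ ?_ ?_) ?_
  · exact (Real.summable_nat_rpow.2 (by linarith)).mul_right _
  · filter_upwards [hg, eventually_le_floor_pow hε hθ, eventually_ge_atTop 1]
      with k hgk hN hk1 y hy hball
    have hk0 : (0 : ℝ) < k := by exact_mod_cast hk1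
    have hg0 : 0 < g k := lt_of_lt_of_le (by positivity) hgk.1
    have hθk : 0 < θ ^ k := by positivity
    have hR : 0 < g k / θ ^ k := by positivity
    have hle : (1 - ε) * (g k / θ ^ k) ≤ g k / θ ^ k :=
      mul_le_of_le_one_left hR.le (by linarith)
    have h1 := h.le_measureReal_closedBall (y := y) (r := (1 - ε) * (g k / θ ^ k)) (m := m)
      (by positivity) fun x hx =>
        have hxX := hball (Metric.closedBall_subset_closedBall hle hx)
        ⟨hxX, hm x hxX⟩
    calc t * Real.log (k * l)
        = (1 - ε) * ((1 - ε) * θ ^ k) * (2 * ((1 - ε) * (g k / θ ^ k)) * m) := by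
          simp only [t, g]; field_simp
      _ ≤ _ := by gcongr
  · filter_upwards [eventually_ge_atTop 1] with k hk1
    have hk0 : (0 : ℝ) < k := by exact_mod_cast hk1
    rw [lintegral_const, measure_univ, mul_one, ← Real.mul_rpow hk0.le hl0.le,
      Real.rpow_def_of_pos (by positivity)]
    refine le_of_eq (congrArg _ (congrArg _ ?_))
    ring
  · obtain ⟨n₀, hn₀⟩ := eventually_atTop.1 hr
    filter_upwards [hloginf.eventually_ge_atTop 0, eventually_ge_atTop 1,
      (tendsto_pow_atTop_atTop_of_one_lt hθ).eventually_ge_atTop (n₀ : ℝ)]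
      with k hk hk1 hkn n hn1 hn2
    have hk0 : (0 : ℝ) < k := by exact_mod_cast hk1
    have hn : n₀ ≤ n := by exact_mod_cast hkn.trans hn1
    have hθk : 0 < θ ^ k := by positivity
    have hn0 : (0 : ℝ) < n := hθk.trans_le hn1
    refine le_trans ?_ (hn₀ n hn).le
    have h1 : k * l ≤ Real.log n := by
      rw [hl, ← Real.log_pow]; exact Real.log_le_log hθk hn1
    have h2 : Real.log (k * l) ≤ Real.log (Real.log n) := Real.log_le_log (by positivity) h1
    calc g k / θ ^ k = c * Real.log (k * l) / θ ^ (k + 1) := by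
          simp only [g]; rw [← hθinv, pow_succ]; field_simp
      _ ≤ c * Real.log (Real.log n) / n := by
          have := hk.trans h2
          gcongr

/-- Integrals of functions of a continuous density. -/
theorem lintegral_ofReal_exp_density (h : HyperbolicRecurrent X f μ ρ) (hρ : ContinuousOn ρ X)
    {b : ℝ} (hb : 0 ≤ b) :
    ∫⁻ y, ENNReal.ofReal (Real.exp (-(b * ρ y - 1))) ∂μ =
      ENNReal.ofReal (Real.exp 1 * ∫ x in X, ρ x * Real.exp (-b * ρ x)) := by
  obtain ⟨S, hS, hρS⟩ := h.exists_density_le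
  have hX := h.ordConnected.measurableSet
  have hm : AEMeasurable ρ (volume.restrict X) := hρ.aemeasurable hX
  have hint : IntegrableOn (fun x => ρ x * Real.exp (-b * ρ x)) X := by
    have : IsFiniteMeasure (volume.restrict X) :=
      ⟨by rw [Measure.restrict_apply_univ]; exact h.isBounded.measure_lt_top⟩
    refine Integrable.of_bound ?_ S ?_
    · exact (hm.mul (Real.measurable_exp.comp_aemeasurable (hm.const_mul _))).aestronglyMeasurable
    · filter_upwards [ae_restrict_mem hX] with x hx
      have h0 := h.density_nonneg x hx
      rw [Real.norm_of_nonneg (by positivity)]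
      refine (mul_le_of_le_one_right h0 ?_).trans (hρS x hx)
      rw [Real.exp_le_one_iff]
      nlinarith
  rw [ENNReal.ofReal_mul (Real.exp_pos 1).le, ofReal_integral_eq_lintegral_ofReal hint]
  · have hm' : AEMeasurable (fun y => ENNReal.ofReal (Real.exp (-(b * ρ y - 1))))
        (volume.restrict X) :=
      (Real.measurable_exp.comp_aemeasurable ((hm.const_mul b).sub_const 1).neg).ennreal_ofReal
    rw [h.eq_withDensity, lintegral_withDensity_eq_lintegral_mul₀ hm.ennreal_ofReal hm',
      ← lintegral_const_mul' _ _ ENNReal.ofReal_ne_top]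
    refine setLIntegral_congr_fun hX fun x hx => ?_
    have h0 := h.density_nonneg x hx
    simp only [Pi.mul_apply]
    rw [← ENNReal.ofReal_mul h0, ← ENNReal.ofReal_mul (Real.exp_pos 1).le]
    congr 1
    rw [show -(b * ρ x - 1) = 1 + -b * ρ x by ring, Real.exp_add]
    ring
  · filter_upwards [ae_restrict_mem hX] with x hx
    have h0 := h.density_nonneg x hx
    simp only [Pi.zero_apply]
    positivity

/-- Almost sure upper bound for a Hölder continuous density. -/
theorem ae_eventually_minReturnDist_lt_of_holder (h : HyperbolicRecurrent X f μ ρ) {γ γ₀ : ℝ}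
    {r : ℕ → ℝ} {L η : NNReal} (hη : 0 < η) (hL : HolderOnWith L η ρ X) (hγ : γ₀ ≤ γ)
    (hr : ∀ᶠ n : ℕ in atTop, Real.log n ^ γ / (2 * n) < r n)
    (hsum : ∀ ε > (0 : ℝ), Summable fun k : ℕ =>
      ∫ x in X, ρ x * Real.exp (-ε * ((k + 1 : ℕ) : ℝ) ^ γ₀ * ρ x)) :
    ∀ᵐ x ∂μ, ∀ᶠ n : ℕ in atTop, minReturnDist f n x < r n := by
  have := h.isProbabilityMeasure
  obtain ⟨m, hm, hmle⟩ := exists_le_log_rpow_div hγ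
  set g : ℕ → ℝ := fun k => m * (k : ℝ) ^ γ₀ with hgdef
  -- The extra power of `k` absorbs the constant `m` from either side.
  set A : ℕ := ⌈|γ₀|⌉₊ + 1
  have hg : ∀ᶠ k : ℕ in atTop, ((k : ℝ) ^ A)⁻¹ ≤ g k ∧ g k ≤ (k : ℝ) ^ A := by
    filter_upwards [eventually_ge_atTop 1,
      (tendsto_natCast_atTop_atTop (R := ℝ)).eventually_ge_atTop m,
      (tendsto_natCast_atTop_atTop (R := ℝ)).eventually_ge_atTop m⁻¹] with k hk1 hkm hkm'
    have hk1' : (1 : ℝ) ≤ k := by exact_mod_cast hk1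
    have hk0 : (0 : ℝ) < k := by linarith
    have hceil : |γ₀| ≤ (⌈|γ₀|⌉₊ : ℝ) := Nat.le_ceil _
    have u1 : (k : ℝ) ^ γ₀ ≤ (k : ℝ) ^ ⌈|γ₀|⌉₊ := by
      rw [← Real.rpow_natCast]
      exact Real.rpow_le_rpow_of_exponent_le hk1' ((le_abs_self _).trans hceil)
    have u2 : ((k : ℝ) ^ ⌈|γ₀|⌉₊)⁻¹ ≤ (k : ℝ) ^ γ₀ := by
      rw [← Real.rpow_natCast, ← Real.rpow_neg hk0.le]
      exact Real.rpow_le_rpow_of_exponent_le hk1' (by linarith [neg_abs_le γ₀])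
    constructor
    · rw [pow_succ, mul_inv, mul_comm]
      have : (k : ℝ)⁻¹ ≤ m := inv_le_of_inv_le₀ hm hkm'
      simp only [g]
      gcongr
    · rw [pow_succ, mul_comm]
      simp only [g]
      gcongr
  have hη0 : (0 : ℝ) < η := by exact_mod_cast hη
  have hsqrt : 1 < Real.sqrt 2 := by
    rw [Real.lt_sqrt (by norm_num)]; norm_num
  -- Replacing the density on the ball by its value at the centre changes the exponent by at most 1:
  -- the Hölder error decays exponentially in `k`, while `g k` is at most polynomial.
  have hcorr : ∀ᶠ k : ℕ in atTop, 1 / 4 * g k * (L * (g k / 2 ^ k) ^ (η : ℝ)) ≤ 1 := by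
    have hb1 : 1 < Real.sqrt 2 ^ (η : ℝ) := Real.one_lt_rpow hsqrt hη0
    filter_upwards [hg, eventually_pow_le_const_mul_pow A hsqrt one_pos,
      eventually_pow_le_const_mul_pow A hb1 (show (0 : ℝ) < 1 / (L + 1) by positivity),
      eventually_ge_atTop 1] with k hgk hk1 hk2 hk3
    have hk0 : (0 : ℝ) < k := by exact_mod_cast hk3
    have hg0 : 0 < g k := lt_of_lt_of_le (by positivity) hgk.1
    have hs0 : 0 < Real.sqrt 2 ^ k := by positivity
    have hR : g k / 2 ^ k ≤ (Real.sqrt 2 ^ k)⁻¹ := by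
      have e : (2 : ℝ) ^ k = Real.sqrt 2 ^ k * Real.sqrt 2 ^ k := by
        rw [← mul_pow, Real.mul_self_sqrt (by norm_num)]
      rw [e, div_le_iff₀ (by positivity), ← mul_assoc, inv_mul_cancel₀ hs0.ne', one_mul]
      linarith [hgk.2]
    have hRη : (g k / 2 ^ k) ^ (η : ℝ) ≤ ((Real.sqrt 2 ^ (η : ℝ)) ^ k)⁻¹ := by
      calc _ ≤ ((Real.sqrt 2 ^ k)⁻¹) ^ (η : ℝ) := Real.rpow_le_rpow (by positivity) hR hη0.le
        _ = _ := by
          rw [Real.inv_rpow hs0.le, ← Real.rpow_natCast, ← Real.rpow_natCast,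
            ← Real.rpow_mul (by positivity), ← Real.rpow_mul (by positivity), mul_comm]
    set w := (Real.sqrt 2 ^ (η : ℝ)) ^ k
    have hw : 0 < w := by positivity
    have hL0 : (0 : ℝ) ≤ L := L.2
    calc 1 / 4 * g k * (L * (g k / 2 ^ k) ^ (η : ℝ))
        ≤ 1 / 4 * (1 / (L + 1) * w) * ((L + 1) * w⁻¹) := by
          gcongr
          · exact hgk.2.trans hk2
          · linarith
      _ = 1 / 4 := by field_simp
      _ ≤ 1 := by norm_num
  -- Sharp constants are not needed, since the series converges for every `ε`; hence the crude
  -- choices `ε = 1/2` and `θ = 2`. The `-1` in `G` pays for the Hölder error and costs a factor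
  -- `e`.
  refine ae_eventually_minReturnDist_lt one_lt_two (R := fun k => g k / 2 ^ k)
    (h.ae_eventually_notMem_noReturnSet one_half_pos one_half_lt_one one_lt_two hg
      (G := fun k y => 1 / 4 * g k * ρ y - 1)
      (u := fun k => Real.exp 1 *
        ∫ x in X, ρ x * Real.exp (-(m / 4) * (k : ℝ) ^ γ₀ * ρ x)) ?_ ?_ ?_) ?_
  · refine Summable.mul_left _ ?_
    rw [← summable_nat_add_iff 1]
    exact hsum (m / 4) (by positivity)
  · filter_upwards [hg, hcorr, eventually_le_floor_pow one_half_pos one_lt_two,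
      eventually_ge_atTop 1] with k hgk hck hN hk1 y hy hball
    have hk0 : (0 : ℝ) < k := by exact_mod_cast hk1
    have hg0 : 0 < g k := lt_of_lt_of_le (by positivity) hgk.1
    set R := g k / 2 ^ k
    have hR : 0 < R := by positivity
    have h1 := h.le_measureReal_closedBall (y := y) (r := (1 - 1 / 2) * R)
      (m := ρ y - L * R ^ (η : ℝ)) (by linarith) fun x hx => by
        have hxR : x ∈ Metric.closedBall y R :=
          Metric.closedBall_subset_closedBall (by linarith) hx
        have hxX := hball hxR
        refine ⟨hxX, ?_⟩
        have h2 := hL.dist_le_of_le hxX hy (Metric.mem_closedBall.1 hxR)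
        rw [Real.dist_eq] at h2
        linarith [(abs_le.1 h2).1]
    have e : g k = 2 ^ k * R := by simp only [R]; field_simp
    calc 1 / 4 * g k * ρ y - 1 ≤ 1 / 4 * g k * ρ y - 1 / 4 * g k * (L * R ^ (η : ℝ)) := by
          linarith
      _ = (1 - 1 / 2) * ((1 - 1 / 2) * 2 ^ k) *
          (2 * ((1 - 1 / 2) * R) * (ρ y - L * R ^ (η : ℝ))) := by rw [e]; ring
      _ ≤ (1 - 1 / 2) * ((1 - 1 / 2) * 2 ^ k) *
          μ.real (Metric.closedBall y ((1 - 1 / 2) * R)) := by gcongr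
      _ ≤ _ := by gcongr
  · filter_upwards [hg, eventually_ge_atTop 1] with k hgk hk1
    have hk0 : (0 : ℝ) < k := by exact_mod_cast hk1
    have hg0 : 0 < g k := lt_of_lt_of_le (by positivity) hgk.1
    rw [h.lintegral_ofReal_exp_density (hL.continuousOn hη) (by positivity : 0 ≤ 1 / 4 * g k)]
    refine le_of_eq ?_
    have e : -(1 / 4 * g k) = -(m / 4) * (k : ℝ) ^ γ₀ := by simp only [g]; ring
    rw [e]
  · obtain ⟨n₀, hn₀⟩ := eventually_atTop.1 hr
    filter_upwards [eventually_ge_atTop 1,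
      (tendsto_pow_atTop_atTop_of_one_lt (one_lt_two (α := ℝ))).eventually_ge_atTop (n₀ : ℝ)]
      with k hk1 hkn n hn1 hn2
    exact (hmle k n hk1 hn1 hn2).trans (hn₀ n (by exact_mod_cast hkn.trans hn1)).le

end HyperbolicRecurrent

/-! ### Almost sure lower bound -/

/-- A closed ball of radius `r` about any point of a cell of length `r` contains the whole cell. -/
theorem sum_measure_cell_sq_le {μ : Measure ℝ} {r : ℝ} (hr : 0 < r) (s : Finset ℤ) :
    ∑ i ∈ s, μ (cell r i) * μ (cell r i) ≤ ∫⁻ x, μ (Metric.closedBall x r) ∂μ := by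
  calc _ ≤ ∑ i ∈ s, ∫⁻ x in cell r i, μ (Metric.closedBall x r) ∂μ := by
        refine Finset.sum_le_sum fun i _ => ?_
        rw [← setLIntegral_const]
        refine setLIntegral_mono' (measurableSet_cell hr i) fun x hx => measure_mono fun y hy => ?_
        rw [mem_cell_iff hr] at hx hy
        rw [Real.closedBall_eq_Icc]
        constructor <;> linarith
    _ = ∫⁻ x in ⋃ i ∈ s, cell r i, μ (Metric.closedBall x r) ∂μ :=
        (lintegral_biUnion_finset (pairwiseDisjoint_cell _ _)
          (fun i _ => measurableSet_cell hr i) _).symm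
    _ ≤ _ := setLIntegral_le_lintegral _ _

theorem lintegral_measure_closedBall_ne_top {μ : Measure ℝ} [IsProbabilityMeasure μ] (r : ℝ) :
    ∫⁻ x, μ (Metric.closedBall x r) ∂μ ≠ ⊤ := by
  refine ne_top_of_le_ne_top ENNReal.one_ne_top ?_
  calc _ ≤ ∫⁻ _, 1 ∂μ := lintegral_mono fun x => prob_le_one
    _ = 1 := by simp

theorem sum_measureReal_cell_sq_le {μ : Measure ℝ} [IsProbabilityMeasure μ] {r : ℝ} (hr : 0 < r)
    (s : Finset ℤ) (t : ℤ) :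
    ∑ i ∈ s, μ.real (cell r (i + t)) ^ 2 ≤ (∫⁻ x, μ (Metric.closedBall x r) ∂μ).toReal := by
  have h1 := sum_measure_cell_sq_le (μ := μ) hr (s.map (addRightEmbedding t))
  rw [Finset.sum_map] at h1
  have h2 := ENNReal.toReal_mono (lintegral_measure_closedBall_ne_top r) h1
  rw [ENNReal.toReal_sum fun i _ => by finiteness] at h2
  refine le_trans (le_of_eq (Finset.sum_congr rfl fun i _ => ?_)) h2
  rw [ENNReal.toReal_mul, pow_two]
  rfl

theorem sum_measureReal_cell_add_le {μ : Measure ℝ} [IsProbabilityMeasure μ] {r : ℝ} (hr : 0 < r)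
    (s : Finset ℤ) (t : ℤ) : ∑ i ∈ s, μ.real (cell r (i + t)) ≤ 1 := by
  have h1 := sum_measureReal_cell_le (μ := μ) hr (s.map (addRightEmbedding t))
    fun i _ => Set.subset_univ _
  rw [Finset.sum_map] at h1
  exact h1.trans measureReal_le_one

namespace HyperbolicRecurrent

variable {X : Set ℝ} {f : ℝ → ℝ} {μ : Measure ℝ} {ρ : ℝ → ℝ}

/-- A point returning within `r`, the cell length, lands in its own cell or an adjacent one.
Decorrelating the two times leaves sums of products of masses of neighbouring cells, which are
controlled by sums of squares. -/
theorem exists_measure_closeReturnSet_le (h : HyperbolicRecurrent X f μ ρ) :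
    ∃ C > (0 : ℝ), ∃ c > (0 : ℝ), ∀ (k : ℕ) (r : ℝ), 0 < r → μ (closeReturnSet X f k r) ≤
      3 * ∫⁻ x, μ (Metric.closedBall x r) ∂μ + ENNReal.ofReal (C * Real.exp (-c * k)) := by
  have := h.isProbabilityMeasure
  obtain ⟨C, hC, c, hc, hdec⟩ := h.exists_decay
  obtain ⟨Λ, hΛ, hcell⟩ := exists_finset_cells h.isBounded
  refine ⟨3 * C, by positivity, c, hc, fun k r hr => ?_⟩
  obtain ⟨s, -, hs⟩ := hcell r hr
  set D := C * Real.exp (-c * k)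
  have hD : 0 ≤ D := by positivity
  set Q := ∫⁻ x, μ (Metric.closedBall x r) ∂μ
  set m : ℤ → ℝ := fun i => μ.real (cell r i)
  have hm0 : ∀ i, 0 ≤ m i := fun i => measureReal_nonneg
  have cellBound : ∀ i, μ.real (closeReturnSet X f k r ∩ cell r i) ≤
      (m (i + -1) ^ 2 / 2 + 2 * m (i + 0) ^ 2 + m (i + 1) ^ 2 / 2) +
        D * (m (i + -1) + m (i + 0) + m (i + 1)) := by
    intro i
    set J := cell r (i + -1) ∪ cell r (i + 0) ∪ cell r (i + 1)
    have hJ : MeasurableSet J := ((measurableSet_cell hr _).union (measurableSet_cell hr _)).union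
      (measurableSet_cell hr _)
    have hJm : μ.real J ≤ m (i + -1) + m (i + 0) + m (i + 1) :=
      (measureReal_union_le _ _).trans (add_le_add (measureReal_union_le _ _) le_rfl)
    have hsub : closeReturnSet X f k r ∩ cell r i ⊆ cell r i ∩ f^[k] ⁻¹' J := by
      rintro x ⟨⟨_, hx⟩, hxi⟩
      refine ⟨hxi, ?_⟩
      rw [mem_cell_iff hr] at hxi
      rw [Real.dist_eq, abs_le] at hx
      rw [Set.mem_preimage]
      simp only [J, Set.mem_union, mem_cell_iff hr]
      push_cast
      rcases lt_or_ge (f^[k] x) (i * r) with h1 | h1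
      · left; left; constructor <;> linarith
      · rcases lt_or_ge (f^[k] x) ((i + 1) * r) with h2 | h2
        · left; right; constructor <;> linarith
        · right; constructor <;> linarith
    have h1 := (abs_le.1 (hdec (cell r i) J (ordConnected_cell hr i) hJ k)).2
    have h2 : μ.real (closeReturnSet X f k r ∩ cell r i) ≤ μ.real (cell r i ∩ f^[k] ⁻¹' J) :=
      measureReal_mono hsub
    have h3 : m i * μ.real J ≤ m i * (m (i + -1) + m (i + 0) + m (i + 1)) :=
      mul_le_mul_of_nonneg_left hJm (hm0 i)
    have h4 : D * μ.real J ≤ D * (m (i + -1) + m (i + 0) + m (i + 1)) :=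
      mul_le_mul_of_nonneg_left hJm hD
    rw [add_zero] at h3 h4 ⊢
    have h5 : μ.real (cell r i ∩ f^[k] ⁻¹' J) ≤ m i * μ.real J + D * μ.real J := by linarith
    -- AM-GM on the two mixed products gives the weights 1/2, 2, 1/2, whose sum is the constant 3.
    nlinarith [sq_nonneg (m i - m (i + -1)), sq_nonneg (m i - m (i + 1))]
  have hcover : μ.real (closeReturnSet X f k r) ≤
      ∑ i ∈ s, μ.real (closeReturnSet X f k r ∩ cell r i) := by
    refine le_trans (measureReal_mono ?_ (measure_ne_top _ _))
      (measureReal_biUnion_finset_le _ _)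
    intro x hx
    have := hs hx.1
    simp only [Set.mem_iUnion] at this
    obtain ⟨i, hi, hxi⟩ := this
    exact Set.mem_biUnion hi ⟨hx, hxi⟩
  have htotal : μ.real (closeReturnSet X f k r) ≤ 3 * Q.toReal + 3 * D := by
    refine hcover.trans ((Finset.sum_le_sum fun i _ => cellBound i).trans ?_)
    simp only [Finset.sum_add_distrib, ← Finset.sum_div, ← Finset.mul_sum]
    have q1 : ∑ i ∈ s, m (i + -1) ^ 2 ≤ Q.toReal := sum_measureReal_cell_sq_le hr s (-1)
    have q2 : ∑ i ∈ s, m (i + 0) ^ 2 ≤ Q.toReal := sum_measureReal_cell_sq_le hr s 0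
    have q3 : ∑ i ∈ s, m (i + 1) ^ 2 ≤ Q.toReal := sum_measureReal_cell_sq_le hr s 1
    have p1 : ∑ i ∈ s, m (i + -1) ≤ 1 := sum_measureReal_cell_add_le hr s (-1)
    have p2 : ∑ i ∈ s, m (i + 0) ≤ 1 := sum_measureReal_cell_add_le hr s 0
    have p3 : ∑ i ∈ s, m (i + 1) ≤ 1 := sum_measureReal_cell_add_le hr s 1
    nlinarith
  rw [← ofReal_measureReal]
  refine (ENNReal.ofReal_le_ofReal htotal).trans ?_
  rw [ENNReal.ofReal_add (by positivity) (by positivity), ENNReal.ofReal_mul (by norm_num),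
    ENNReal.ofReal_toReal (lintegral_measure_closedBall_ne_top r), mul_assoc, ENNReal.ofReal_ofNat]

/-- Periodic points form a null set. -/
theorem ae_iterate_ne (h : HyperbolicRecurrent X f μ ρ) :
    ∀ᵐ x ∂μ, ∀ j : ℕ, 1 ≤ j → f^[j] x ≠ x := by
  have := h.isProbabilityMeasure
  obtain ⟨β, hβ, C, hC, hE⟩ := h.exists_closeReturn_bound
  have hL : Tendsto (fun n : ℕ => Real.log n ^ 2) atTop atTop :=
    (tendsto_pow_atTop two_ne_zero).comp
      (Real.tendsto_log_atTop.comp tendsto_natCast_atTop_atTop)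
  refine ae_all_iff.2 fun j => ?_
  by_cases hj : 1 ≤ j
  swap
  · exact Eventually.of_forall fun x h1 => absurd h1 hj
  -- Points fixed by `f^[j]` return at every scale `n^(-1/2)`, and `j ≤ (log n)²` for large `n`, so
  -- (A2) bounds their measure by a null sequence.
  have hzero : μ.real {x ∈ X | f^[j] x = x} = 0 := by
    refine le_antisymm ?_ measureReal_nonneg
    have hlim : Tendsto (fun n : ℕ => C * (n : ℝ) ^ (-(β / 2))) atTop (𝓝 (C * 0)) :=
      ((tendsto_rpow_neg_atTop (half_pos hβ.1)).comp tendsto_natCast_atTop_atTop).const_mul C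
    rw [mul_zero] at hlim
    refine ge_of_tendsto hlim ?_
    filter_upwards [hE, hL.eventually_ge_atTop (j : ℝ)] with n hn hnj
    refine (measureReal_mono ?_).trans (hn j hj hnj)
    rintro x ⟨hx, hxj⟩
    refine ⟨hx, ?_⟩
    rw [hxj, dist_self]
    positivity
  rw [measureReal_eq_zero_iff] at hzero
  have hz : ∀ᵐ x ∂μ, ¬ (x ∈ X ∧ f^[j] x = x) := by
    rw [ae_iff]; simpa using hzero
  filter_upwards [h.ae_mem, hz] with x hx hxj _ heq
  exact hxj ⟨hx, heq⟩

/-- Otherwise each of the finitely many cells covering `X` would be null. -/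
theorem lintegral_measure_closedBall_ne_zero (h : HyperbolicRecurrent X f μ ρ) {δ : ℝ}
    (hδ : 0 < δ) : ∫⁻ x, μ (Metric.closedBall x δ) ∂μ ≠ 0 := by
  have := h.isProbabilityMeasure
  intro h0
  obtain ⟨Λ, hΛ, hcell⟩ := exists_finset_cells h.isBounded
  obtain ⟨s, -, hs⟩ := hcell δ hδ
  have h1 := sum_measure_cell_sq_le (μ := μ) hδ s
  rw [h0, nonpos_iff_eq_zero, Finset.sum_eq_zero_iff] at h1
  have h2 : μ (⋃ i ∈ s, cell δ i) = 0 :=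
    (measure_biUnion_null_iff s.countable_toSet).2 fun i hi => by simpa using h1 i hi
  have h3 : ∀ᵐ x ∂μ, x ∉ ⋃ i ∈ s, cell δ i := measure_eq_zero_iff_ae_notMem.1 h2
  obtain ⟨x, hx1, hx2⟩ := (h.ae_mem.and h3).exists
  exact hx2 (hs hx1)

/-- If the radii never dropped below `δ`, every term of the series would be at least the fixed
positive integral for radius `δ`, contradicting convergence. -/
theorem eventually_lt_of_tsum_lt_top (h : HyperbolicRecurrent X f μ ρ) {r : ℕ → ℝ}
    (hr : AntitoneOn r (Set.Ici 1))
    (hsum : ∑' n : ℕ, ∫⁻ x, μ (Metric.closedBall x (r (n + 1))) ∂μ < ⊤) {δ : ℝ} (hδ : 0 < δ) :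
    ∀ᶠ n in atTop, r n < δ := by
  by_cases hex : ∃ m ≥ 1, r m < δ
  · obtain ⟨m, hm, hlt⟩ := hex
    filter_upwards [eventually_ge_atTop m] with n hn
    exact (hr hm (hm.trans hn) hn).trans_lt hlt
  · push Not at hex
    exfalso
    refine h.lintegral_measure_closedBall_ne_zero hδ (nonpos_iff_eq_zero.1 ?_)
    refine ge_of_tendsto' (ENNReal.tendsto_atTop_zero_of_tsum_ne_top hsum.ne) fun n => ?_
    exact lintegral_mono fun x =>
      measure_mono (Metric.closedBall_subset_closedBall (hex _ (by omega)))

theorem ae_eventually_lt_minReturnDist (h : HyperbolicRecurrent X f μ ρ) {r : ℕ → ℝ}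
    (hr : AntitoneOn r (Set.Ici 1))
    (hsum : ∑' n : ℕ, ∫⁻ x, μ (Metric.closedBall x (r (n + 1))) ∂μ < ⊤) :
    ∀ᵐ x ∂μ, ∀ᶠ n : ℕ in atTop, r n < minReturnDist f n x := by
  have := h.isProbabilityMeasure
  obtain ⟨C, hC, c, hc, hbound⟩ := h.exists_measure_closeReturnSet_le
  have hB : ∀ n : ℕ, μ (closeReturnSet X f (n + 1) (r (n + 1))) ≤
      3 * ∫⁻ x, μ (Metric.closedBall x (r (n + 1))) ∂μ +
        ENNReal.ofReal (C * Real.exp (-c * (n + 1 : ℕ))) := by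
    intro n
    -- Radii need not be positive; for a nonpositive one a close return is a periodic point.
    rcases lt_or_ge 0 (r (n + 1)) with h0 | h0
    · exact hbound _ _ h0
    · have : μ (closeReturnSet X f (n + 1) (r (n + 1))) = 0 := by
        refine measure_mono_null (t := {x | ¬ ∀ j : ℕ, 1 ≤ j → f^[j] x ≠ x}) ?_ h.ae_iterate_ne
        rintro x ⟨_, hx⟩ hper
        exact hper (n + 1) (by omega) (dist_le_zero.1 (hx.trans h0)).symm
      rw [this]; exact zero_le
  have hexp : Summable fun n : ℕ => C * Real.exp (-c * (n + 1 : ℕ)) := by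
    have h1 := Real.summable_exp_nat_mul_iff.2 (show -c < 0 by linarith)
    have h2 := ((summable_nat_add_iff 1).2 h1).mul_left C
    simpa only [mul_comm (-c)] using h2
  have hne : ∑' n : ℕ, μ (closeReturnSet X f (n + 1) (r (n + 1))) ≠ ⊤ := by
    refine ne_top_of_le_ne_top ?_ (ENNReal.tsum_le_tsum hB)
    rw [ENNReal.tsum_add, ENNReal.tsum_mul_left]
    exact ENNReal.add_ne_top.2
      ⟨ENNReal.mul_ne_top (by norm_num) hsum.ne, hexp.tsum_ofReal_ne_top⟩
  filter_upwards [ae_eventually_notMem hne, h.ae_iterate_ne, h.ae_mem] with x hx hper hxX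
  obtain ⟨K, hK⟩ := eventually_atTop.1 hx
  have hlarge : ∀ k, K + 1 ≤ k → r k < dist (f^[k] x) x := by
    intro k hk
    obtain ⟨m, rfl⟩ : ∃ m, k = m + 1 := ⟨k - 1, by omega⟩
    by_contra hle
    refine hK m (by omega) ⟨hxX, ?_⟩
    rw [dist_comm]
    exact not_lt.1 hle
  -- The times `k ≤ K`, not reached by Borel–Cantelli, have fixed positive return distances, which
  -- `r n` eventually undercuts.
  have hsmall : ∀ᶠ n in atTop, ∀ k ∈ Finset.Icc 1 K, r n < dist (f^[k] x) x := by
    rw [Filter.eventually_all_finset]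
    intro k hk
    exact h.eventually_lt_of_tsum_lt_top hr hsum (dist_pos.2 (hper k (Finset.mem_Icc.1 hk).1))
  filter_upwards [hsmall, eventually_ge_atTop 1] with n hn hn1
  have hmem : minReturnDist f n x ∈ (fun k : ℕ => dist (f^[k] x) x) '' Set.Icc 1 n :=
    Set.Nonempty.csInf_mem ⟨_, 1, ⟨le_rfl, hn1⟩, rfl⟩ ((Set.finite_Icc 1 n).image _)
  obtain ⟨k, hk, hkeq⟩ := hmem
  rw [← hkeq]
  rcases le_or_gt k K with hkK | hkK
  · exact hn k (Finset.mem_Icc.2 ⟨hk.1, hkK⟩)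
  -- For late times, `r n ≤ r k` since `k ≤ n`, and the return distance at time `k` already exceeds
  -- `r k`.
  · exact (hr hk.1 hn1 hk.2).trans_lt (hlarge k hkK)

end HyperbolicRecurrent

end Recurrence

theorem mainTheorem2 (X : Set ℝ) (f : ℝ → ℝ) (μ : Measure ℝ) (ρ : ℝ → ℝ)
    (h : Recurrence.HyperbolicRecurrent X f μ ρ) :
    -- upper bound, density bounded below
    (∀ (c : ℝ) (r : ℕ → ℝ), (∀ x ∈ X, 0 < ρ x) → 1 < 2 * c * sInf (ρ '' X) →
      (∀ᶠ n : ℕ in atTop, c * Real.log (Real.log n) / n < r n) →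
      ∀ᵐ x ∂μ, ∀ᶠ n : ℕ in atTop, Recurrence.minReturnDist f n x < r n) ∧
    -- upper bound, Hölder density
    (∀ (γ γ₀ : ℝ) (r : ℕ → ℝ), (∃ (L η : NNReal), 0 < η ∧ HolderOnWith L η ρ X) →
      γ₀ < γ → (∀ᶠ n : ℕ in atTop, Real.log n ^ γ / (2 * n) < r n) →
      (∀ ε > (0 : ℝ), Summable fun k : ℕ =>
        ∫ x in X, ρ x * Real.exp (-ε * ((k + 1 : ℕ) : ℝ) ^ γ₀ * ρ x)) →
      ∀ᵐ x ∂μ, ∀ᶠ n : ℕ in atTop, Recurrence.minReturnDist f n x < r n) ∧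
    -- lower bound
    (∀ r : ℕ → ℝ, AntitoneOn r (Set.Ici 1) →
      ∑' n : ℕ, ∫⁻ x, μ (Metric.closedBall x (r (n + 1))) ∂μ < ⊤ →
      ∀ᵐ x ∂μ, ∀ᶠ n : ℕ in atTop, r n < Recurrence.minReturnDist f n x) := by
  refine ⟨fun c r hρ hc hr => h.ae_eventually_minReturnDist_lt_of_pos hρ hc hr,
    fun γ γ₀ r hρ hγ hr hsum => ?_, fun r hr hsum => h.ae_eventually_lt_minReturnDist hr hsum⟩
  obtain ⟨L, η, hη, hL⟩ := hρ
  exact h.ae_eventually_minReturnDist_lt_of_holder hη hL hγ.le hr hsum
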